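/- Let $p\ge 1$ and let $\Gamma^p$ be the set of directed acyclic graphs (DAGs) on $[p]=\{1,\dots,p\}$. For $\gamma\in\Gamma^p$ let $\mathrm{pa}^\gamma(j)$ be the set of parents of $j$ and $|\gamma|$ the number of edges; $\gamma\supseteq\gamma'$ means that every edge of $\gamma'$ is an edge of $\gamma$. **True model.** Fix $\gamma^*\in\Gamma^p$ and vectors $\beta^*_j\in\mathbb R^{|\mathrm{pa}^{\gamma^*}(j)|}$ with nonzero entries. Let $X=(X_1,\dots,X_p)^{\mathsf T}$ satisfy $X_j=X_{\mathrm{pa}^{\gamma^*}(j)}^{\mathsf T}\beta^*_j+\epsilon_j$, $j\in[p]$, where $\epsilon_1,\dots,\epsilon_p$ are independent (not necessarily Gaussian or identically distributed) with mean $0$ and common variance $\sigma^2\in(0,\infty)$. The data $D_n$ are $n$ i.i.d. copies $X^{(1)},\dots,X^{(n)}$ of $X$; $\mathsf P^*$ and $\mathsf E_*$ are probability and expectation under this model. For $\gamma\in\Gamma^p$ put $r^\gamma=\sum_{j=1}^p\min_{b}\mathsf E_*\big(X_j-X_{\mathrm{pa}^\gamma(j)}^{\mathsf T}b\big)^2$.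 **Posterior.** For $\gamma\in\Gamma^p$ let $\ell(D_n\mid b,\theta,\gamma)$ be the likelihood of the working model in which $X^{(1)},\dots,X^{(n)}$ are i.i.d. with $X_j=X_{\mathrm{pa}^\gamma(j)}^{\mathsf T}b_j+e_j$, $e_j\sim \mathrm N(0,\theta)$ independent, $j\in[p]$. Let $D^\gamma_{j,n}$ be the $n\times|\mathrm{pa}^\gamma(j)|$ matrix of observations of $X_{\mathrm{pa}^\gamma(j)}$. Given $\theta$, let the $b_j$ be independent with $b_j\sim \mathrm N\big(0,g\,\theta\,(D_{j,n}^{\gamma\,\mathsf T}D^\gamma_{j,n})^{-1}\big)$, with $g=n$, and let $\theta>0$ have the improper Jeffreys density $1/\theta$. Let $m(D_n\mid\gamma)$ be the integral of $\ell$ with respect to this prior of $(b,\theta)$. Let $\pi$ be a probability distribution on $\Gamma^p$ with $\pi(\gamma)>0$ for all $\gamma$ and, for some $C>0$, $\pi(\gamma)/\pi(\gamma')\le C$ for all $\gamma,\gamma'\in\Gamma^p$. Put $\pi(\gamma\mid D_n)=m(D_n\mid\gamma)\pi(\gamma)\big/\sum_{\gamma'}m(D_n\mid\gamma')\pi(\gamma')$.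 This is well defined when all matrices $D_{j,n}^{\gamma\,\mathsf T}D^\gamma_{j,n}$ are invertible and the denominator is positive and finite. **Theorem.** Let $\delta^*=\min_{\gamma\not\supseteq\gamma^*}\log r^\gamma-\log(p\sigma^2)$, with $\delta^*=+\infty$ if $\gamma^*$ has no edges (then the minimum is over the empty set, and the second term below is $0$). Then $\delta^*>0$; the posterior is well defined with $\mathsf P^*$-probability tending to $1$ as $n\to\infty$; and, whenever $n\ge1$ and the posterior is well defined, $$1-\pi(\gamma^*\mid D_n)\le \frac1{\sqrt n}\exp(O_p(1))+\exp\Big(-\frac{np}{2}\big(\delta^*+o_p(1)\big)\Big)(1+n)^{|\gamma^*|/2},$$ where $O_p(1)$ and $o_p(1)$ stand for sequences of random variables that are, respectively, bounded in $\mathsf P^*$-probability and convergent to $0$ in $\mathsf P^*$-probability. If $\gamma^*$ is complete (any two distinct nodes are joined by an edge), the same bound holds without the term $n^{-1/2}\exp(O_p(1))$. In particular, $\pi(\gamma^*\mid D_n)\to1$ in $\mathsf P^*$-probability. -/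

import Mathlib

open MeasureTheory ProbabilityTheory Filter Topology
open scoped ENNReal NNReal Matrix

noncomputable section

namespace EqualVarSEM

/-- A directed acyclic graph with node set `Fin p`; `(k, j) ∈ edges` means `k → j`. -/
@[ext]
structure DAG (p : ℕ) where
  edges : Finset (Fin p × Fin p)
  acyclic : ∀ j, ¬ Relation.TransGen (fun k l => (k, l) ∈ edges) j j

instance (p : ℕ) : Fintype (DAG p) :=
  Fintype.ofInjective DAG.edges (fun _ _ h => DAG.ext h)

/-- The set of parents of the node `j`. -/
def DAG.parents {p : ℕ} (γ : DAG p) (j : Fin p) : Finset (Fin p) :=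
  Finset.univ.filter (fun k => (k, j) ∈ γ.edges)

/-- A DAG is complete if any two distinct nodes are joined by an edge. -/
def DAG.IsComplete {p : ℕ} (γ : DAG p) : Prop :=
  ∀ j k : Fin p, j ≠ k → (j, k) ∈ γ.edges ∨ (k, j) ∈ γ.edges

/-- The data-generating model: independent copies `X i`, `i = 0, 1, 2, …`, of a random vector that
follows the linear structural equation model with true DAG `γs`, nonzero coefficients `β`, and
mutually independent errors `ε i j ∼ ν j` with mean zero and common variance `σ ^ 2 > 0`. -/
structure IsSample {Ω : Type*} [MeasurableSpace Ω] (P : Measure Ω) {p : ℕ} (γs : DAG p)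
    (β : (j : Fin p) → γs.parents j → ℝ) (ν : Fin p → Measure ℝ) (σ : ℝ)
    (ε X : ℕ → Ω → Fin p → ℝ) : Prop where
  coeff_ne_zero : ∀ j k, β j k ≠ 0
  sigma_pos : 0 < σ
  measurable_error : ∀ i, Measurable (ε i)
  measurable_obs : ∀ i, Measurable (X i)
  law_error : ∀ i j, HasLaw (fun ω => ε i ω j) (ν j) P
  indep_error : iIndepFun (fun (q : ℕ × Fin p) ω => ε q.1 ω q.2) P
  memLp_error : ∀ j, MemLp id 2 (ν j)
  mean_error : ∀ j, ∫ x, x ∂(ν j) = 0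
  var_error : ∀ j, variance id (ν j) = σ ^ 2
  structural_eq : ∀ i ω j, X i ω j = (∑ k : γs.parents j, X i ω k * β j k) + ε i ω j

/-- `r^γ`: the sum over the nodes of the minimal expected squared error of linear prediction of a
coordinate of the random vector `Y` from the coordinates in its parent set. -/
def risk {Ω : Type*} [MeasurableSpace Ω] (P : Measure Ω) {p : ℕ} (Y : Ω → Fin p → ℝ)
    (γ : DAG p) : ℝ :=
  ∑ j, ⨅ b : γ.parents j → ℝ, ∫ ω, (Y ω j - ∑ k : γ.parents j, Y ω k * b k) ^ 2 ∂P

/-- The gaps `log r^γ - log (p σ²)` of the DAGs `γ` that are not supergraphs of `γs`. -/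
def gaps {Ω : Type*} [MeasurableSpace Ω] (P : Measure Ω) {p : ℕ} (Y : Ω → Fin p → ℝ)
    (σ : ℝ) (γs : DAG p) : Set ℝ :=
  {d | ∃ γ : DAG p, ¬ γs.edges ⊆ γ.edges ∧ d = Real.log (risk P Y γ) - Real.log (p * σ ^ 2)}

/-- `δ*`, the smallest gap (there is none if and only if `γs` has no edges). -/
def minGap {Ω : Type*} [MeasurableSpace Ω] (P : Measure Ω) {p : ℕ} (Y : Ω → Fin p → ℝ)
    (σ : ℝ) (γs : DAG p) : ℝ :=
  sInf (gaps P Y σ γs)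

/-- The matrix whose rows are the observations of the parents of node `j`. -/
def design {n p : ℕ} (x : Fin n → Fin p → ℝ) (γ : DAG p) (j : Fin p) :
    Matrix (Fin n) (γ.parents j) ℝ :=
  Matrix.of fun i k => x i k

/-- The Gram matrix `DᵀD` of the design matrix of node `j`. -/
def gram {n p : ℕ} (x : Fin n → Fin p → ℝ) (γ : DAG p) (j : Fin p) :
    Matrix (γ.parents j) (γ.parents j) ℝ :=
  (design x γ j)ᵀ * design x γ j

/-- Coefficient vectors `b^γ`: one vector for each node, indexed by the parents of the node. -/
abbrev Coeffs {p : ℕ} (γ : DAG p) : Type :=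
  (j : Fin p) → EuclideanSpace ℝ (γ.parents j)

/-- The likelihood of the data `x` under the working Gaussian model with DAG `γ`, coefficients `b`
and error variance `θ`. -/
def likelihood {n p : ℕ} (x : Fin n → Fin p → ℝ) (γ : DAG p) (b : Coeffs γ) (θ : ℝ) : ℝ≥0∞ :=
  ∏ i, ∏ j, gaussianPDF (∑ k : γ.parents j, x i k * b j k) θ.toNNReal (x i j)

/-- The DAG-g-prior: given `θ`, the vectors `b j` are independent `N(0, g θ (DᵀD)⁻¹)`. -/
def coeffPrior {n p : ℕ} (g : ℝ) (x : Fin n → Fin p → ℝ) (γ : DAG p) (θ : ℝ) :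
    Measure (Coeffs γ) :=
  Measure.pi fun j => multivariateGaussian 0 ((g * θ) • (gram x γ j)⁻¹)

/-- The marginal likelihood `m(x | γ)` under the DAG-g-prior and the Jeffreys prior `1 / θ`. -/
def evidence {n p : ℕ} (g : ℝ) (x : Fin n → Fin p → ℝ) (γ : DAG p) : ℝ≥0∞ :=
  ∫⁻ θ in Set.Ioi (0 : ℝ),
    (∫⁻ b, likelihood x γ b θ ∂(coeffPrior g x γ θ)) * ENNReal.ofReal (1 / θ)

/-- The normalizing constant of the posterior distribution. -/
def totalEvidence {n p : ℕ} (g : ℝ) (pr : PMF (DAG p)) (x : Fin n → Fin p → ℝ) : ℝ≥0∞ :=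
  ∑ γ, evidence g x γ * pr γ

/-- The posterior probability of the DAG `γ` given the data `x`, for the DAG prior `pr`. -/
def posterior {n p : ℕ} (g : ℝ) (pr : PMF (DAG p)) (x : Fin n → Fin p → ℝ) (γ : DAG p) : ℝ :=
  (evidence g x γ * pr γ / totalEvidence g pr x).toReal

/-- The posterior is well defined: all matrices `DᵀD` that the g-prior inverts are invertible, and
the normalizing constant is positive and finite. -/
def PosteriorDefined {n p : ℕ} (g : ℝ) (pr : PMF (DAG p)) (x : Fin n → Fin p → ℝ) : Prop :=
  (∀ (γ : DAG p) (j : Fin p), IsUnit (gram x γ j).det) ∧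
    totalEvidence g pr x ≠ 0 ∧ totalEvidence g pr x ≠ ∞

/-- The data set formed by the first `n` observations. -/
def data {Ω : Type*} {p : ℕ} (X : ℕ → Ω → Fin p → ℝ) (n : ℕ) (ω : Ω) : Fin n → Fin p → ℝ :=
  fun i => X i ω

/-- `A n` is a sequence of random variables that is `O_p(1)`. -/
def IsBigOp {Ω : Type*} [MeasurableSpace Ω] (P : Measure Ω) (A : ℕ → Ω → ℝ) : Prop :=
  (∀ n, Measurable (A n)) ∧
    ∀ η : ℝ, 0 < η → ∃ M : ℝ, ∀ᶠ n in atTop, P {ω | M < |A n ω|} ≤ ENNReal.ofReal η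

/-- `B n` is a sequence of random variables that is `o_p(1)`. -/
def IsLittleOp {Ω : Type*} [MeasurableSpace Ω] (P : Measure Ω) (B : ℕ → Ω → ℝ) : Prop :=
  (∀ n, Measurable (B n)) ∧ TendstoInMeasure P B atTop (fun _ => 0)

/-- `exp (-(n p / 2) (δ + b)) (1 + n)^{|γs| / 2}`, read as `0` if `γs` has no edges, in which case
every DAG is a supergraph of `γs` and the minimum that defines `δ` is `+∞`. -/
def expTerm {p : ℕ} (γs : DAG p) (n : ℕ) (δ b : ℝ) : ℝ :=
  open Classical in
  if γs.edges = ∅ then 0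
  else Real.exp (-((n : ℝ) * p / 2) * (δ + b)) * (1 + (n : ℝ)) ^ ((γs.edges.card : ℝ) / 2)

end EqualVarSEM

end

-- Integrating out the coefficients completes a square at each node. The evidence of `γ` becomes `(1
-- + g)^(-|γ|/2)` times an integral over `θ` that sees the data only through the shrunk residual sum
-- of squares `S_γ` (`evidence_eq`). Since `dθ/θ` is scale invariant, that integral is a constant
-- times `S_γ^(-np/2)` (`scaleIntegral_mul`). With `g = n`, the posterior odds of `γ` against `γs`
-- are thus the prior odds times `(1 + n)^((|γs| - |γ|)/2) * (S_γs / S_γ)^(np/2)`, and `1 - π(γs |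
-- D)` is at most the sum of these odds (`one_sub_posterior_le`). By the strong law `S_γ / n` tends
-- almost surely to the risk `r^γ`.
--
-- Non-supergraphs lose exponentially, by identifiability (`subset_of_score_popMoment_le`). Let `B`
-- be the true coefficient matrix and `W` that of the best predictions along `γ`. Then `r^γ = σ²
-- tr(M Mᵀ)` with `M = (1 - W)(1 - B)⁻¹`, and `det M = 1` because both factors come from acyclic
-- graphs. The arithmetic-geometric mean inequality for the eigenvalues of `M Mᵀ` gives `r^γ ≥ pσ²`,
-- with equality only if `M` is orthogonal. In that case `(1 - W)ᵀ(1 - W) = (1 - B)ᵀ(1 - B)`, which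
-- forces `W = B` (`eq_of_transpose_mul_self_eq`), and as the true coefficients do not vanish, `γ`
-- contains `γs`. Hence `δ* > 0`.
--
-- Proper supergraphs lose only by their dimension: each has an extra edge, which costs a factor of
-- order `n^(-1/2)`. Their gain in fit is bounded by the projection of the noise on the parents
-- (`score_sub_score_le`). By acyclicity the parents of `j`, even in a supergraph, do not depend on
-- the error of `j` (`totalEffects_eq_zero`), so this projection is `O_p(1)` by Chebyshev's
-- inequality (`isBigOp_noise`). A complete graph has no proper supergraph, so the first term
-- disappears.

noncomputable section

namespace EqualVarSEM

-- Acyclic coefficient matrices and identifiability from the precision matrix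

section Acyclic

open Classical in
/-- The number of ancestors of a node; it strictly increases along edges. -/
def DAG.rank {p : ℕ} (γ : DAG p) (j : Fin p) : ℕ :=
  (Finset.univ.filter (fun k => Relation.TransGen (fun k l => (k, l) ∈ γ.edges) k j)).card

lemma DAG.rank_lt {p : ℕ} (γ : DAG p) {k j : Fin p} (h : (k, j) ∈ γ.edges) :
    γ.rank k < γ.rank j := by
  classical
  refine Finset.card_lt_card ((Finset.ssubset_iff_of_subset ?_).2 ⟨k, ?_, ?_⟩)
  · intro l hl
    simp only [Finset.mem_filter, Finset.mem_univ, true_and] at hl ⊢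
    exact hl.tail h
  · simpa using Relation.TransGen.single h
  · simpa using γ.acyclic k

lemma DAG.mem_parents {p : ℕ} (γ : DAG p) {k j : Fin p} :
    k ∈ γ.parents j ↔ (k, j) ∈ γ.edges := by
  simp [DAG.parents]

lemma DAG.sum_card_parents {p : ℕ} (γ : DAG p) :
    ∑ j, (γ.parents j).card = γ.edges.card := by
  rw [Finset.card_eq_sum_card_fiberwise (f := Prod.snd) (t := Finset.univ) (by simp)]
  refine Finset.sum_congr rfl fun j _ => ?_
  refine Finset.card_bij (fun k _ => (k, j)) ?_ ?_ ?_
  · intro k hk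
    simpa [DAG.mem_parents] using hk
  · intro a _ b _ h
    simpa using h
  · rintro ⟨a, b⟩ h
    simp only [Finset.mem_filter] at h
    obtain ⟨h1, rfl⟩ := h
    exact ⟨a, by simpa [DAG.mem_parents] using h1, rfl⟩

variable {m : Type*} [Fintype m] [DecidableEq m]

/-- Nodes of equal rank are never joined, so `1 - W` is block triangular along the ranks with
identity diagonal blocks. Ties in rank are harmless, and no linear order has to be chosen. -/
lemma det_one_sub_eq_one_of_rank {W : Matrix m m ℝ} (r : m → ℕ)
    (hW : ∀ j k, W j k ≠ 0 → r k < r j) : (1 - W).det = 1 := by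
  rw [← Matrix.det_transpose]
  have hB : (1 - W)ᵀ.BlockTriangular r := by
    intro i j hij
    have h1 : W j i = 0 := by
      by_contra h
      exact absurd (hW j i h) (by omega)
    have h2 : j ≠ i := by rintro rfl; omega
    simp [h1, h2]
  rw [hB.det]
  refine Finset.prod_eq_one fun a _ => ?_
  have : (1 - W)ᵀ.toSquareBlock r a = 1 := by
    ext ⟨i, hi⟩ ⟨j, hj⟩
    have h1 : W j i = 0 := by
      by_contra h
      exact absurd (hW j i h) (by omega)
    simp [Matrix.toSquareBlock_def, h1, Matrix.one_apply]
  rw [this, Matrix.det_one]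

/-- The equality case of the inequality of arithmetic and geometric means, for the eigenvalues of
`M Mᵀ`. -/
lemma mul_transpose_eq_one_of_trace_le {M : Matrix m m ℝ} (hdet : M.det = 1)
    (htr : (M * Mᵀ).trace ≤ Fintype.card m) : M * Mᵀ = 1 := by
  have hpsd : (M * Mᵀ).PosSemidef := by
    simpa using Matrix.posSemidef_self_mul_conjTranspose M
  have hH := hpsd.isHermitian
  have hd : ∏ i, hH.eigenvalues i = 1 := by
    have := hH.det_eq_prod_eigenvalues
    simpa [hdet] using this.symm
  have hs : ∑ i, hH.eigenvalues i ≤ Fintype.card m := by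
    have := hH.trace_eq_sum_eigenvalues
    simp only [RCLike.ofReal_real_eq_id, id_eq] at this
    linarith
  have hpos : ∀ i, 0 < hH.eigenvalues i := by
    intro i
    refine lt_of_le_of_ne (hpsd.eigenvalues_nonneg i) fun h => ?_
    rw [Finset.prod_eq_zero (Finset.mem_univ i) h.symm] at hd
    exact zero_ne_one hd
  have hlog : ∑ i, Real.log (hH.eigenvalues i) = 0 := by
    rw [← Real.log_prod (fun i _ => (hpos i).ne'), hd, Real.log_one]
  -- The terms `λ - 1 - log λ` are nonnegative and their sum is at most zero by the trace bound, so
  -- each vanishes; strict concavity of the logarithm then leaves only `λ = 1`.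
  have hnn : ∀ i ∈ Finset.univ, 0 ≤ hH.eigenvalues i - 1 - Real.log (hH.eigenvalues i) := by
    intro i _
    linarith [Real.log_le_sub_one_of_pos (hpos i)]
  have hz : ∑ i, (hH.eigenvalues i - 1 - Real.log (hH.eigenvalues i)) = 0 := by
    refine le_antisymm ?_ (Finset.sum_nonneg hnn)
    simp only [Finset.sum_sub_distrib, hlog, Finset.sum_const, Finset.card_univ, nsmul_eq_mul]
    linarith
  have hone : hH.eigenvalues = fun _ => 1 := by
    funext i
    by_contra hne
    have h1 := (Finset.sum_eq_zero_iff_of_nonneg hnn).1 hz i (Finset.mem_univ i)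
    have h2 := Real.log_lt_sub_one_of_pos (hpos i) hne
    linarith
  have hsp := hH.spectral_theorem
  rw [hone] at hsp
  have : Matrix.diagonal ((RCLike.ofReal : ℝ → ℝ) ∘ fun _ : m => (1 : ℝ)) = 1 := by
    ext i j
    simp [Matrix.diagonal_apply, Matrix.one_apply]
  rw [this, map_one] at hsp
  exact hsp

/-- The structural matrix of a linear model with an acyclic graph and equal error variances is
determined by the precision matrix. -/
lemma eq_of_transpose_mul_self_eq {W B : Matrix m m ℝ} (r : m → ℕ)
    (hW : ∀ j k, W j k ≠ 0 → r k < r j) (hB : ∀ j, B j j = 0)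
    (h : (1 - W)ᵀ * (1 - W) = (1 - B)ᵀ * (1 - B)) : W = B := by
  have hWd : ∀ j, W j j = 0 := fun j => by
    by_contra hj
    exact lt_irrefl _ (hW j j hj)
  -- Rows are recovered from the highest rank downwards. The children `c` of `j` in `W` have higher
  -- rank, so their rows already agree. The `(j, j)` entries then show that column `j` of `B` has no
  -- further nonzero entries, and the `(j, k)` entries give row `j`. Subtracting from the sum of all
  -- ranks reverses the order without truncation.
  have key : ∀ N j, (∑ i, r i) - r j = N → ∀ k, W j k = B j k := by
    intro N
    induction N using Nat.strong_induction_on with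
    | _ N ih =>
    intro j hj
    have hrow : ∀ c, W c j ≠ 0 → ∀ k, W c k = B c k := by
      intro c hc
      have h1 := hW c j hc
      have h2 : r c ≤ ∑ i, r i := Finset.single_le_sum (fun _ _ => Nat.zero_le _)
        (Finset.mem_univ c)
      exact ih _ (by omega) c rfl
    have expand : ∀ (V : Matrix m m ℝ) (a b : m), ((1 - V)ᵀ * (1 - V) : Matrix m m ℝ) a b =
        (1 : Matrix m m ℝ) a b - V a b - V b a + ∑ c, V c a * V c b := by
      intro V a b
      simp only [Matrix.transpose_sub, Matrix.transpose_one, Matrix.sub_mul, Matrix.mul_sub,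
        Matrix.one_mul, Matrix.mul_one, Matrix.sub_apply, Matrix.transpose_apply]
      rw [Matrix.mul_apply]
      simp only [Matrix.transpose_apply]
      ring
    have hcolsq : ∑ c, (B c j ^ 2 - W c j ^ 2) = 0 := by
      have h1 := congrFun (congrFun h j) j
      rw [expand, expand, hWd, hB] at h1
      rw [Finset.sum_sub_distrib]
      simp only [pow_two]
      linarith
    have hnn : ∀ c ∈ Finset.univ, 0 ≤ B c j ^ 2 - W c j ^ 2 := by
      intro c _
      by_cases hc : W c j = 0
      · simp [hc, sq_nonneg]
      · simp [hrow c hc j]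
    have hcol : ∀ c, W c j = B c j := by
      intro c
      by_cases hc : W c j = 0
      · have := (Finset.sum_eq_zero_iff_of_nonneg hnn).1 hcolsq c (Finset.mem_univ c)
        rw [hc] at this ⊢
        exact (pow_eq_zero_iff two_ne_zero |>.1 (by simpa using this)).symm
      · exact hrow c hc j
    intro k
    have h1 := congrFun (congrFun h j) k
    rw [expand, expand, hcol k] at h1
    have h2 : ∑ c, W c j * W c k = ∑ c, B c j * B c k := by
      refine Finset.sum_congr rfl fun c _ => ?_
      rw [← hcol c]
      by_cases hc : W c j = 0
      · simp [hc]
      · rw [hrow c hc k]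
    linarith
  ext j k
  exact key _ j rfl k

end Acyclic

-- Linear prediction as a function of the second-moment matrix

section Projection

variable {m : Type*}

/-- The vector of second moments of the coordinates in `s` with the coordinate `j`. -/
def cross (Y : Matrix m m ℝ) (s : Finset m) (j : m) : s → ℝ := fun k => Y k j

/-- The second moments of the coordinates in `s`. -/
def block (Y : Matrix m m ℝ) (s : Finset m) : Matrix s s ℝ :=
  Y.submatrix (fun k => (k : m)) (fun k => (k : m))

/-- The mean square of the linear projection of the coordinate `j` on the coordinates in `s`. -/
def explained [DecidableEq m] (Y : Matrix m m ℝ) (s : Finset m) (j : m) : ℝ :=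
  cross Y s j ⬝ᵥ (block Y s)⁻¹ *ᵥ cross Y s j

/-- The mean square error of the linear prediction of the coordinate `j` from the coordinates in
`s` with the coefficients `b`. -/
def predError (Y : Matrix m m ℝ) (s : Finset m) (j : m) (b : s → ℝ) : ℝ :=
  Y j j - 2 * (b ⬝ᵥ cross Y s j) + b ⬝ᵥ block Y s *ᵥ b

/-- Completion of the square. The remainder is expressed by the residual of the normal equations
instead of `b - G⁻¹ y`: at the true coefficients that residual is the moment of the parents with the
error. -/
lemma predError_eq [DecidableEq m] {Y : Matrix m m ℝ} (hY : Y.IsSymm) {s : Finset m}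
    (hdet : IsUnit (block Y s).det) (j : m) (b : s → ℝ) :
    predError Y s j b = Y j j - explained Y s j +
      (cross Y s j - block Y s *ᵥ b) ⬝ᵥ (block Y s)⁻¹ *ᵥ (cross Y s j - block Y s *ᵥ b) := by
  have hsymm : (block Y s)ᵀ = block Y s := by
    ext a c
    exact hY.apply _ _
  have hinv : ((block Y s)⁻¹)ᵀ = (block Y s)⁻¹ := by
    rw [Matrix.transpose_nonsing_inv, hsymm]
  set y := cross Y s j with hy
  set G := block Y s with hG
  have h1 : G⁻¹ *ᵥ (G *ᵥ b) = b := by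
    rw [Matrix.mulVec_mulVec, Matrix.nonsing_inv_mul _ hdet, Matrix.one_mulVec]
  have h2 : (G *ᵥ b) ⬝ᵥ (G⁻¹ *ᵥ y) = b ⬝ᵥ y := by
    rw [Matrix.dotProduct_mulVec, ← Matrix.mulVec_transpose, hinv, h1]
  simp only [predError, explained, ← hy, ← hG, Matrix.mulVec_sub, dotProduct_sub,
    sub_dotProduct, h1, h2]
  rw [dotProduct_comm y b, dotProduct_comm (G *ᵥ b) b]
  ring

lemma predError_inv [DecidableEq m] {Y : Matrix m m ℝ} (hY : Y.IsSymm) {s : Finset m}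
    (hdet : IsUnit (block Y s).det) (j : m) :
    predError Y s j ((block Y s)⁻¹ *ᵥ cross Y s j) = Y j j - explained Y s j := by
  rw [predError_eq hY hdet, Matrix.mulVec_mulVec, Matrix.mul_nonsing_inv _ hdet,
    Matrix.one_mulVec]
  simp

lemma sub_explained_le_predError [DecidableEq m] [Fintype m] {Y : Matrix m m ℝ} (hY : Y.PosSemidef)
    {s : Finset m} (hdet : IsUnit (block Y s).det) (j : m) (b : s → ℝ) :
    Y j j - explained Y s j ≤ predError Y s j b := by
  have hS : Y.IsSymm := by simpa using hY.isHermitian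
  rw [predError_eq hS hdet]
  have h : (block Y s)⁻¹.PosSemidef := (hY.submatrix _).inv
  have := h.dotProduct_mulVec_nonneg (cross Y s j - block Y s *ᵥ b)
  simp only [star_trivial] at this
  linarith

/-- Extension of a coefficient vector by zero. -/
def extend [DecidableEq m] (s : Finset m) (b : s → ℝ) : m → ℝ :=
  fun k => if h : k ∈ s then b ⟨k, h⟩ else 0

lemma sum_extend [DecidableEq m] [Fintype m] (s : Finset m) (b : s → ℝ) (f : m → ℝ) :
    ∑ k, extend s b k * f k = ∑ k : s, b k * f k := by
  rw [← Finset.sum_subset (Finset.subset_univ s), ← Finset.sum_coe_sort s]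
  · refine Finset.sum_congr rfl fun k _ => ?_
    simp [extend]
  · intro k _ hk
    simp [extend, hk]

/-- Extension by zero removes the dependence of the index type on the parent set. This allows
coefficients to be moved between parent sets and read as rows of `1 - W`. -/
lemma predError_eq_quadratic [DecidableEq m] [Fintype m] {Y : Matrix m m ℝ} (hY : Y.IsSymm)
    (s : Finset m) (j : m) (b : s → ℝ) :
    predError Y s j b =
      (Pi.single j 1 - extend s b) ⬝ᵥ Y *ᵥ (Pi.single j 1 - extend s b) := by
  have h1 : ∀ v : m → ℝ, extend s b ⬝ᵥ v = ∑ k : s, b k * v k := fun v => sum_extend s b v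
  have h2 : ∀ i, (Y *ᵥ extend s b) i = ∑ k : s, b k * Y i k := by
    intro i
    rw [← sum_extend s b]
    simp [Matrix.mulVec, dotProduct, mul_comm]
  simp only [predError, Matrix.mulVec_sub, dotProduct_sub, sub_dotProduct]
  have h3 : Pi.single j 1 ⬝ᵥ Y *ᵥ extend s b = b ⬝ᵥ cross Y s j := by
    rw [single_one_dotProduct, h2]
    refine Finset.sum_congr rfl fun k _ => ?_
    rw [cross, hY.apply]
  have h4 : extend s b ⬝ᵥ Y *ᵥ Pi.single j 1 = b ⬝ᵥ cross Y s j := by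
    rw [h1]
    refine Finset.sum_congr rfl fun k _ => ?_
    simp [cross]
  have h5 : extend s b ⬝ᵥ Y *ᵥ extend s b = b ⬝ᵥ block Y s *ᵥ b := by
    rw [h1]
    refine Finset.sum_congr rfl fun k _ => ?_
    rw [h2]
    simp [block, Matrix.mulVec, dotProduct, mul_comm]
  rw [h3, h4, h5]
  simp
  ring

/-- The sum over the nodes of the squared errors of linear prediction from the parents, where the
explained part is shrunk by the factor `c`. -/
def score {p : ℕ} (c : ℝ) (Y : Matrix (Fin p) (Fin p) ℝ) (γ : DAG p) : ℝ :=
  ∑ j, (Y j j - c * explained Y (γ.parents j) j)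

lemma explained_smul [DecidableEq m] (t : ℝ) (ht : t ≠ 0) (Y : Matrix m m ℝ) (s : Finset m)
    (j : m) (hdet : IsUnit (block Y s).det) :
    explained (t • Y) s j = t * explained Y s j := by
  have h1 : cross (t • Y) s j = t • cross Y s j := rfl
  have h2 : block (t • Y) s = t • block Y s := rfl
  have : Invertible t := invertibleOfNonzero ht
  rw [explained, h1, h2, Matrix.inv_smul _ _ hdet]
  simp [explained, Matrix.mulVec_smul, Matrix.smul_mulVec, ht]

end Projection

-- Gaussian integrals under the g-prior

section GaussianIntegrals

lemma lintegral_pi_prod {ι : Type*} [Fintype ι] {E : ι → Type*} [∀ i, MeasurableSpace (E i)]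
    (μ : ∀ i, Measure (E i)) [∀ i, IsProbabilityMeasure (μ i)] (f : ∀ i, E i → ℝ≥0∞)
    (hf : ∀ i, Measurable (f i)) :
    ∫⁻ x, ∏ i, f i (x i) ∂(Measure.pi μ) = ∏ i, ∫⁻ y, f i y ∂(μ i) := by
  have h : iIndepFun (fun i (x : ∀ i, E i) => f i (x i)) (Measure.pi μ) :=
    iIndepFun_pi fun i => (hf i).aemeasurable
  have h1 := lintegral_prod_eq_prod_lintegral_of_indepFun Finset.univ _ h
    (fun i => (hf i).comp (measurable_pi_apply i))
  rw [h1]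
  refine Finset.prod_congr rfl fun i _ => ?_
  exact (measurePreserving_eval μ i).lintegral_comp (hf i)

/-- The tilted standard density is the stated constant times the density of `N(c/(1+a), 1/(1+a))`,
which integrates to one. -/
lemma lintegral_exp_gaussianReal (a c : ℝ) (ha : 0 ≤ a) :
    ∫⁻ z, ENNReal.ofReal (Real.exp (c * z - a * z ^ 2 / 2)) ∂(gaussianReal 0 1) =
      ENNReal.ofReal ((√(1 + a))⁻¹ * Real.exp (c ^ 2 / (2 * (1 + a)))) := by
  have hpos : 0 < 1 + a := by linarith
  set v : ℝ≥0 := ⟨(1 + a)⁻¹, by positivity⟩ with hv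
  have hvr : (v : ℝ) = (1 + a)⁻¹ := rfl
  have hv0 : v ≠ 0 := by
    intro h
    have : (v : ℝ) = 0 := by rw [h]; rfl
    rw [hvr] at this
    exact (inv_ne_zero hpos.ne') this
  rw [gaussianReal_of_var_ne_zero 0 one_ne_zero,
    lintegral_withDensity_eq_lintegral_mul _ (measurable_gaussianPDF 0 1) (by fun_prop)]
  have : ∀ z, (gaussianPDF 0 1 * fun z => ENNReal.ofReal (Real.exp (c * z - a * z ^ 2 / 2))) z =
      ENNReal.ofReal ((√(1 + a))⁻¹ * Real.exp (c ^ 2 / (2 * (1 + a)))) *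
        gaussianPDF (c / (1 + a)) v z := by
    intro z
    rw [Pi.mul_apply, gaussianPDF_def, gaussianPDF_def,
      ← ENNReal.ofReal_mul (gaussianPDFReal_nonneg _ _ _), ← ENNReal.ofReal_mul (by positivity)]
    congr 1
    simp only [gaussianPDFReal_def, hvr, NNReal.coe_one]
    have h1 : √(2 * Real.pi * (1 + a)⁻¹) = √(2 * Real.pi * 1) * (√(1 + a))⁻¹ := by
      rw [Real.sqrt_mul (by positivity), Real.sqrt_inv, mul_one]
    rw [h1, mul_inv, inv_inv, mul_assoc, ← Real.exp_add]
    have h2 : -(z - 0) ^ 2 / (2 * 1) + (c * z - a * z ^ 2 / 2) =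
        c ^ 2 / (2 * (1 + a)) + -(z - c / (1 + a)) ^ 2 / (2 * (1 + a)⁻¹) := by
      field_simp
      ring
    rw [h2, Real.exp_add]
    have : √(1 + a) ≠ 0 := (Real.sqrt_pos.2 hpos).ne'
    field_simp
  simp_rw [this]
  rw [lintegral_const_mul _ (measurable_gaussianPDF _ _), lintegral_gaussianPDF_eq_one _ hv0,
    mul_one]

variable {ι : Type*} [Fintype ι]

lemma lintegral_exp_stdGaussian (a : ℝ) (ha : 0 ≤ a) (c : ι → ℝ) :
    ∫⁻ z, ENNReal.ofReal (Real.exp (c ⬝ᵥ z.ofLp - a * (z.ofLp ⬝ᵥ z.ofLp) / 2))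
      ∂(stdGaussian (EuclideanSpace ℝ ι)) =
      ENNReal.ofReal ((√(1 + a))⁻¹ ^ Fintype.card ι *
        Real.exp (c ⬝ᵥ c / (2 * (1 + a)))) := by
  rw [← map_pi_eq_stdGaussian, lintegral_map (by fun_prop) (by fun_prop)]
  have h : ∀ z : ι → ℝ, ENNReal.ofReal (Real.exp (c ⬝ᵥ z - a * (z ⬝ᵥ z) / 2)) =
      ∏ i, ENNReal.ofReal (Real.exp (c i * z i - a * (z i) ^ 2 / 2)) := by
    intro z
    rw [← ENNReal.ofReal_prod_of_nonneg (fun _ _ => (Real.exp_pos _).le), ← Real.exp_sum]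
    congr 2
    simp only [dotProduct, Finset.sum_sub_distrib, Finset.mul_sum, Finset.sum_div, pow_two]
  simp_rw [h]
  rw [lintegral_pi_prod (fun _ : ι => gaussianReal 0 1)
    (fun i z => ENNReal.ofReal (Real.exp (c i * z - a * z ^ 2 / 2))) (fun i => by fun_prop)]
  simp_rw [lintegral_exp_gaussianReal a _ ha]
  rw [← ENNReal.ofReal_prod_of_nonneg (fun _ _ => by positivity), Finset.prod_mul_distrib,
    ← Real.exp_sum]
  simp [dotProduct, Finset.sum_div, pow_two]

open scoped MatrixOrder in
/-- The integral of a Gaussian likelihood under a `g`-prior. -/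
lemma lintegral_exp_gPrior [DecidableEq ι] {G : Matrix ι ι ℝ} (hG : G.PosSemidef) (hdet : IsUnit G.det)
    {g θ : ℝ} (hg : 0 ≤ g) (hθ : 0 < θ) (T : ℝ) (y : ι → ℝ) :
    ∫⁻ b, ENNReal.ofReal (Real.exp (-(T - 2 * (b.ofLp ⬝ᵥ y) + b.ofLp ⬝ᵥ G *ᵥ b.ofLp) / (2 * θ)))
      ∂(multivariateGaussian 0 ((g * θ) • G⁻¹)) =
      ENNReal.ofReal ((√(1 + g))⁻¹ ^ Fintype.card ι *
        Real.exp (-(T - g / (1 + g) * (y ⬝ᵥ G⁻¹ *ᵥ y)) / (2 * θ))) := by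
  have hS : ((g * θ) • G⁻¹).PosSemidef := hG.inv.smul (by positivity)
  -- The prior is the law of `A z` with `z` standard normal. As `A G A = gθ`, the quadratic part of
  -- the exponent becomes `g |z|² / 2` and the coordinates of `z` separate.
  set A := CFC.sqrt ((g * θ) • G⁻¹) with hA
  have hAA : A * A = (g * θ) • G⁻¹ := CFC.sqrt_mul_sqrt_self _ hS.nonneg
  have hAt : Aᵀ = A := by
    have := (CFC.sqrt_nonneg ((g * θ) • G⁻¹)).isSelfAdjoint.star_eq
    rwa [Matrix.star_eq_conjTranspose, Matrix.conjTranspose_eq_transpose_of_trivial] at this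
  have hAGA : A * G * A = (g * θ) • (1 : Matrix ι ι ℝ) := by
    have h1 : A * (A * G) = (g * θ) • (1 : Matrix ι ι ℝ) := by
      rw [← Matrix.mul_assoc, hAA, Matrix.smul_mul, Matrix.nonsing_inv_mul _ hdet]
    -- For `g = 0` the prior is a point mass and `A = 0`; otherwise `A` is invertible and can be
    -- cancelled.
    rcases eq_or_lt_of_le hg with h0 | h0
    · have : A * Aᵀ = 0 := by rw [hAt, hAA, ← h0]; simp
      have h2 : A = 0 := by
        have := (Matrix.self_mul_conjTranspose_eq_zero (A := A)).1 (by simpa using this)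
        exact this
      simp [h2, ← h0]
    · have hne : g * θ ≠ 0 := (mul_pos h0 hθ).ne'
      have h2 : A * ((g * θ)⁻¹ • (A * G)) = 1 := by
        rw [Matrix.mul_smul, h1, smul_smul, inv_mul_cancel₀ hne, one_smul]
      have h3 := mul_eq_one_comm.1 h2
      rw [Matrix.smul_mul] at h3
      rw [← h3, smul_smul, mul_inv_cancel₀ hne, one_smul]
  rw [multivariateGaussian, lintegral_map (by fun_prop) (by fun_prop)]
  have hexp : ∀ z : EuclideanSpace ℝ ι,
      ENNReal.ofReal (Real.exp (-(T - 2 * ((0 + Matrix.toEuclideanCLM (𝕜 := ℝ) A z).ofLp ⬝ᵥ y) +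
        (0 + Matrix.toEuclideanCLM (𝕜 := ℝ) A z).ofLp ⬝ᵥ
          G *ᵥ (0 + Matrix.toEuclideanCLM (𝕜 := ℝ) A z).ofLp) / (2 * θ))) =
      ENNReal.ofReal (Real.exp (-T / (2 * θ))) *
        ENNReal.ofReal (Real.exp ((θ⁻¹ • A *ᵥ y) ⬝ᵥ z.ofLp - g * (z.ofLp ⬝ᵥ z.ofLp) / 2)) := by
    intro z
    rw [← ENNReal.ofReal_mul (Real.exp_pos _).le, ← Real.exp_add, zero_add]
    have h0 : (Matrix.toEuclideanCLM (𝕜 := ℝ) A z).ofLp = A *ᵥ z.ofLp := rfl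
    have h1 : (A *ᵥ z.ofLp) ⬝ᵥ y = (A *ᵥ y) ⬝ᵥ z.ofLp := by
      rw [dotProduct_comm, Matrix.dotProduct_mulVec, ← Matrix.mulVec_transpose, hAt]
    have h2 : (A *ᵥ z.ofLp) ⬝ᵥ G *ᵥ (A *ᵥ z.ofLp) = g * θ * (z.ofLp ⬝ᵥ z.ofLp) := by
      have : (A *ᵥ z.ofLp) ⬝ᵥ G *ᵥ (A *ᵥ z.ofLp) = z.ofLp ⬝ᵥ (A * G * A) *ᵥ z.ofLp := by
        rw [← Matrix.mulVec_mulVec, ← Matrix.mulVec_mulVec, Matrix.dotProduct_mulVec z.ofLp,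
          ← Matrix.mulVec_transpose, hAt]
      rw [this, hAGA, Matrix.smul_mulVec, Matrix.one_mulVec, dotProduct_smul, smul_eq_mul]
    rw [h0, h1, h2, smul_dotProduct, smul_eq_mul]
    congr 2
    field_simp
    ring
  simp_rw [← hA, hexp]
  rw [lintegral_const_mul _ (by fun_prop), lintegral_exp_stdGaussian g hg,
    ← ENNReal.ofReal_mul (Real.exp_pos _).le]
  have h3 : (θ⁻¹ • A *ᵥ y) ⬝ᵥ (θ⁻¹ • A *ᵥ y) = g * θ⁻¹ * (y ⬝ᵥ G⁻¹ *ᵥ y) := by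
    have : (A *ᵥ y) ⬝ᵥ (A *ᵥ y) = g * θ * (y ⬝ᵥ G⁻¹ *ᵥ y) := by
      rw [Matrix.dotProduct_mulVec, ← Matrix.mulVec_transpose, hAt, Matrix.mulVec_mulVec, hAA,
        dotProduct_comm, Matrix.smul_mulVec, dotProduct_smul, smul_eq_mul]
    rw [smul_dotProduct, dotProduct_smul, this, smul_eq_mul, smul_eq_mul]
    field_simp
  rw [h3, mul_left_comm, ← Real.exp_add]
  congr 3
  field_simp
  ring

end GaussianIntegrals

-- The integral over the error variance

section ScaleIntegral

/-- The integral over the error variance that defines the marginal likelihood of `N` observations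
with shrunk residual sum of squares `S`. -/
def scaleIntegral (N : ℕ) (S : ℝ) : ℝ≥0∞ :=
  ∫⁻ θ in Set.Ioi (0 : ℝ),
    ENNReal.ofReal ((√(2 * Real.pi * θ))⁻¹ ^ N * Real.exp (-S / (2 * θ)) * (1 / θ))

/-- Substitute `θ = t u`: the measure `dθ/θ` is invariant, so only the Gaussian normalization
contributes a power of `t`. -/
lemma scaleIntegral_mul (N : ℕ) (S : ℝ) {t : ℝ} (ht : 0 < t) :
    scaleIntegral N (t * S) = ENNReal.ofReal ((√t)⁻¹ ^ N) * scaleIntegral N S := by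
  have himg : (fun u : ℝ => t * u) '' Set.Ioi 0 = Set.Ioi 0 := by
    simpa using Set.image_mul_left_Ioi ht 0
  have hinj : Set.InjOn (fun u : ℝ => t * u) (Set.Ioi 0) :=
    fun a _ b _ h => mul_left_cancel₀ ht.ne' h
  have hder : ∀ x ∈ Set.Ioi (0 : ℝ), HasDerivWithinAt (fun u : ℝ => t * u) t (Set.Ioi 0) x := by
    intro x _
    simpa using ((hasDerivAt_id x).const_mul t).hasDerivWithinAt
  have h := lintegral_image_eq_lintegral_abs_deriv_mul measurableSet_Ioi hder hinj
    (fun θ => ENNReal.ofReal ((√(2 * Real.pi * θ))⁻¹ ^ N * Real.exp (-(t * S) / (2 * θ)) *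
      (1 / θ)))
  rw [himg] at h
  rw [scaleIntegral, h, scaleIntegral, ← lintegral_const_mul _ (by fun_prop)]
  refine setLIntegral_congr_fun measurableSet_Ioi fun u hu => ?_
  have hu : 0 < u := hu
  rw [← ENNReal.ofReal_mul (abs_nonneg t), ← ENNReal.ofReal_mul (by positivity), abs_of_pos ht]
  congr 1
  have h1 : √(2 * Real.pi * (t * u)) = √t * √(2 * Real.pi * u) := by
    rw [← Real.sqrt_mul ht.le]
    congr 1
    ring
  have h2 : -(t * S) / (2 * (t * u)) = -S / (2 * u) := by
    field_simp
  rw [h1, h2, mul_inv, mul_pow]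
  field_simp

lemma scaleIntegral_ne_zero (N : ℕ) (S : ℝ) : scaleIntegral N S ≠ 0 := by
  rw [scaleIntegral, ← pos_iff_ne_zero, setLIntegral_pos_iff (by fun_prop)]
  have : Set.Ioi (0 : ℝ) ⊆ (Function.support fun θ : ℝ => ENNReal.ofReal
      ((√(2 * Real.pi * θ))⁻¹ ^ N * Real.exp (-S / (2 * θ)) * (1 / θ))) ∩ Set.Ioi 0 := by
    intro θ hθ
    have hθ' : 0 < θ := hθ
    refine ⟨?_, hθ⟩
    simp only [Function.mem_support, ne_eq, ENNReal.ofReal_eq_zero, not_le]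
    have := Real.pi_pos
    positivity
  refine lt_of_lt_of_le ?_ (measure_mono this)
  simp

/-- Rescaling leaves `S = 0` fixed but multiplies the nonzero integral by `2^(-N)`, which is
impossible for a finite value. -/
lemma scaleIntegral_zero {N : ℕ} (hN : N ≠ 0) : scaleIntegral N 0 = ∞ := by
  by_contra h
  have h1 := scaleIntegral_mul N 0 (t := 4) (by norm_num)
  have h2 : √(4 : ℝ) = 2 := by
    rw [show (4 : ℝ) = 2 ^ 2 by norm_num]
    exact Real.sqrt_sq (by norm_num)
  rw [mul_zero, h2] at h1
  have h3 : ENNReal.ofReal ((2 : ℝ)⁻¹ ^ N) = 1 := by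
    have h4 : 1 * scaleIntegral N 0 = ENNReal.ofReal ((2 : ℝ)⁻¹ ^ N) * scaleIntegral N 0 := by
      rw [one_mul]; exact h1
    exact ((ENNReal.mul_left_inj (scaleIntegral_ne_zero N 0) h).1 h4).symm
  rw [ENNReal.ofReal_eq_one] at h3
  exact absurd h3 (pow_lt_one₀ (by norm_num) (by norm_num) hN).ne

lemma scaleIntegral_one_ne_top {N : ℕ} (hN : N ≠ 0) : scaleIntegral N 1 ≠ ∞ := by
  have hsplit : Set.Ioi (0 : ℝ) = Set.Ioc 0 1 ∪ Set.Ioi 1 := by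
    rw [Set.Ioc_union_Ioi_eq_Ioi zero_le_one]
  have hpi : (1 : ℝ) ≤ 2 * Real.pi := by linarith [Real.pi_gt_three]
  have hsq : ∀ θ : ℝ, 0 < θ → (√(2 * Real.pi * θ))⁻¹ ≤ (√θ)⁻¹ := by
    intro θ hθ
    have : √θ ≤ √(2 * Real.pi * θ) := Real.sqrt_le_sqrt (by nlinarith)
    exact inv_anti₀ (Real.sqrt_pos.2 hθ) this
  rw [scaleIntegral, hsplit]
  refine ((lintegral_union_le _ _ _).trans_lt (ENNReal.add_lt_top.2 ⟨?_, ?_⟩)).ne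
  -- Near zero, `x^(N+1)/(N+1)! ≤ exp x` at `x = 1/(2θ)` yields a factor `(2θ)^(N+1)`. It cancels
  -- the `N` factors bounded by `1/θ` and the Jeffreys density, leaving `K`.
  · set K : ℝ := (N + 1).factorial * 2 ^ (N + 1) with hK
    have hb : ∀ θ ∈ Set.Ioc (0 : ℝ) 1, ENNReal.ofReal
        ((√(2 * Real.pi * θ))⁻¹ ^ N * Real.exp (-1 / (2 * θ)) * (1 / θ)) ≤ ENNReal.ofReal K := by
      rintro θ ⟨h0, h1⟩
      refine ENNReal.ofReal_le_ofReal ?_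
      have e1 : (√(2 * Real.pi * θ))⁻¹ ≤ θ⁻¹ := by
        refine (hsq θ h0).trans (inv_anti₀ h0 ?_)
        exact Real.le_sqrt_of_sq_le (by nlinarith)
      have e2 : Real.exp (-1 / (2 * θ)) ≤ (N + 1).factorial * (2 * θ) ^ (N + 1) := by
        have := Real.pow_div_factorial_le_exp (1 / (2 * θ)) (by positivity) (N + 1)
        rw [neg_div, Real.exp_neg]
        refine (inv_anti₀ (by positivity) this).trans (le_of_eq ?_)
        rw [inv_div, one_div, inv_pow, div_inv_eq_mul]
      calc (√(2 * Real.pi * θ))⁻¹ ^ N * Real.exp (-1 / (2 * θ)) * (1 / θ)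
          ≤ θ⁻¹ ^ N * ((N + 1).factorial * (2 * θ) ^ (N + 1)) * (1 / θ) := by
            gcongr
        _ = K := by
            rw [hK, mul_pow, inv_pow, pow_succ θ N]
            field_simp
    refine (setLIntegral_mono measurable_const hb).trans_lt ?_
    simp
  -- At infinity a single factor `θ^(-1/2)`, available since `N ≠ 0`, makes the Jeffreys tail
  -- integrable.
  · have hint : IntegrableOn (fun θ : ℝ => θ ^ (-(3 / 2) : ℝ)) (Set.Ioi 1) :=
      integrableOn_Ioi_rpow_of_lt (by norm_num) one_pos
    have hb : ∀ θ ∈ Set.Ioi (1 : ℝ), ENNReal.ofReal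
        ((√(2 * Real.pi * θ))⁻¹ ^ N * Real.exp (-1 / (2 * θ)) * (1 / θ)) ≤
          ENNReal.ofReal (θ ^ (-(3 / 2) : ℝ)) := by
      intro θ h1
      have h1 : 1 < θ := h1
      have h0 : 0 < θ := by linarith
      refine ENNReal.ofReal_le_ofReal ?_
      have e0 : (√(2 * Real.pi * θ))⁻¹ ≤ 1 :=
        (hsq θ h0).trans (inv_le_one_of_one_le₀ (Real.one_le_sqrt.2 h1.le))
      have e1 : (√(2 * Real.pi * θ))⁻¹ ^ N ≤ (√θ)⁻¹ :=
        (pow_le_of_le_one (by positivity) e0 hN).trans (hsq θ h0)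
      have e2 : Real.exp (-1 / (2 * θ)) ≤ 1 :=
        Real.exp_le_one_iff.2 (div_nonpos_of_nonpos_of_nonneg (by norm_num) (by positivity))
      calc (√(2 * Real.pi * θ))⁻¹ ^ N * Real.exp (-1 / (2 * θ)) * (1 / θ)
          ≤ (√θ)⁻¹ * 1 * (1 / θ) := by gcongr
        _ = θ ^ (-(3 / 2) : ℝ) := by
            rw [mul_one, Real.sqrt_eq_rpow, ← Real.rpow_neg h0.le, one_div θ, ← Real.rpow_neg_one θ,
              ← Real.rpow_add h0]
            norm_num
    refine (setLIntegral_mono' measurableSet_Ioi hb).trans_lt ?_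
    exact (hint.lintegral_lt_top)

end ScaleIntegral

-- The marginal likelihood in closed form

section Evidence

variable {n p : ℕ}

/-- The matrix of the sums of products of the coordinates of the observations. -/
def sumProd (x : Fin n → Fin p → ℝ) : Matrix (Fin p) (Fin p) ℝ :=
  (Matrix.of x)ᵀ * Matrix.of x

lemma sumProd_apply (x : Fin n → Fin p → ℝ) (k l : Fin p) :
    sumProd x k l = ∑ i, x i k * x i l := by
  simp [sumProd, Matrix.mul_apply]

lemma sumProd_posSemidef (x : Fin n → Fin p → ℝ) : (sumProd x).PosSemidef := by
  simpa [sumProd] using Matrix.posSemidef_conjTranspose_mul_self (Matrix.of x)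

lemma gram_eq_block (x : Fin n → Fin p → ℝ) (γ : DAG p) (j : Fin p) :
    gram x γ j = block (sumProd x) (γ.parents j) := by
  ext k l
  simp [gram, block, sumProd_apply, design, Matrix.mul_apply]

lemma predError_sumProd (x : Fin n → Fin p → ℝ) (s : Finset (Fin p)) (j : Fin p) (b : s → ℝ) :
    predError (sumProd x) s j b = ∑ i, (x i j - ∑ k : s, x i k * b k) ^ 2 := by
  have hsymm : (sumProd x).IsSymm := by simpa using (sumProd_posSemidef x).isHermitian
  rw [predError_eq_quadratic hsymm, sumProd, ← Matrix.mulVec_mulVec, Matrix.dotProduct_mulVec,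
    ← Matrix.mulVec_transpose, Matrix.transpose_transpose]
  simp only [dotProduct]
  refine Finset.sum_congr rfl fun i _ => ?_
  have : (Matrix.of x *ᵥ (Pi.single j 1 - extend s b)) i = x i j - ∑ k : s, x i k * b k := by
    rw [Matrix.mulVec_sub, Pi.sub_apply, Matrix.mulVec_single_one]
    simp only [Matrix.mulVec, dotProduct, Matrix.col_apply, Matrix.of_apply]
    congr 1
    have := sum_extend s b (fun k => x i k)
    simp only [mul_comm] at this ⊢
    exact this
  rw [this, pow_two]

lemma likelihood_eq (x : Fin n → Fin p → ℝ) (γ : DAG p) (b : Coeffs γ) {θ : ℝ} (hθ : 0 < θ) :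
    likelihood x γ b θ = ENNReal.ofReal ((√(2 * Real.pi * θ))⁻¹ ^ (n * p)) *
      ∏ j, ENNReal.ofReal (Real.exp
        (-predError (sumProd x) (γ.parents j) j (b j).ofLp / (2 * θ))) := by
  rw [likelihood, Finset.prod_comm]
  have h : ∀ j, ∏ i, gaussianPDF (∑ k : γ.parents j, x i k * b j k) θ.toNNReal (x i j) =
      ENNReal.ofReal ((√(2 * Real.pi * θ))⁻¹ ^ n) * ENNReal.ofReal (Real.exp
        (-predError (sumProd x) (γ.parents j) j (b j).ofLp / (2 * θ))) := by
    intro j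
    simp only [gaussianPDF, gaussianPDFReal, Real.coe_toNNReal _ hθ.le]
    rw [← ENNReal.ofReal_prod_of_nonneg (fun _ _ => by positivity), Finset.prod_mul_distrib,
      ← Real.exp_sum, ← ENNReal.ofReal_mul (by positivity), predError_sumProd]
    simp [← Finset.sum_div]
  simp_rw [h]
  rw [Finset.prod_mul_distrib, Finset.prod_const, Finset.card_univ, Fintype.card_fin,
    ← ENNReal.ofReal_pow (by positivity), ← pow_mul]

/-- Given `θ`, likelihood and prior both factor over the nodes, and each node contributes one
Gaussian integral. The exponents of `(1 + g)^(-1/2)` add up to the number of edges, the sum of the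
sizes of the parent sets. -/
lemma evidence_eq (x : Fin n → Fin p → ℝ) (γ : DAG p) {g : ℝ} (hg : 0 ≤ g)
    (hdet : ∀ j, IsUnit (gram x γ j).det) :
    evidence g x γ = ENNReal.ofReal ((√(1 + g))⁻¹ ^ γ.edges.card) *
      scaleIntegral (n * p) (score (g / (1 + g)) (sumProd x) γ) := by
  rw [evidence, scaleIntegral, ← lintegral_const_mul _ (by fun_prop)]
  refine setLIntegral_congr_fun measurableSet_Ioi fun θ hθ => ?_
  have hθ : 0 < θ := hθ
  simp_rw [likelihood_eq x γ _ hθ]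
  rw [coeffPrior, lintegral_const_mul _ (by unfold predError cross block; fun_prop),
    lintegral_pi_prod _ (fun j (v : EuclideanSpace ℝ (γ.parents j)) => ENNReal.ofReal (Real.exp
        (-predError (sumProd x) (γ.parents j) j v.ofLp / (2 * θ))))
        (fun j => by unfold predError cross block; fun_prop)]
  have h : ∀ j, ∫⁻ v : EuclideanSpace ℝ (γ.parents j), ENNReal.ofReal (Real.exp
      (-predError (sumProd x) (γ.parents j) j v.ofLp / (2 * θ)))
      ∂(multivariateGaussian 0 ((g * θ) • (gram x γ j)⁻¹)) =
      ENNReal.ofReal ((√(1 + g))⁻¹ ^ (γ.parents j).card *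
        Real.exp (-(sumProd x j j - g / (1 + g) * explained (sumProd x) (γ.parents j) j)
          / (2 * θ))) := by
    intro j
    have hd := hdet j
    rw [gram_eq_block] at hd ⊢
    have := lintegral_exp_gPrior ((sumProd_posSemidef x).submatrix _) hd hg hθ
      (sumProd x j j) (cross (sumProd x) (γ.parents j) j)
    rw [Fintype.card_coe] at this
    exact this
  simp_rw [h]
  rw [← ENNReal.ofReal_prod_of_nonneg (fun _ _ => by positivity), Finset.prod_mul_distrib,
    ← Real.exp_sum, Finset.prod_pow_eq_pow_sum, γ.sum_card_parents, ← Finset.sum_div,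
    Finset.sum_neg_distrib, ← score, ← ENNReal.ofReal_mul (by positivity),
    ← ENNReal.ofReal_mul (by positivity), ← ENNReal.ofReal_mul (by positivity)]
  congr 1
  ring

end Evidence

-- Posterior odds and their deterministic bounds

section PosteriorBounds

variable {n p : ℕ}

/-- The matrix of the empirical second moments. -/
def meanProd (x : Fin n → Fin p → ℝ) : Matrix (Fin p) (Fin p) ℝ :=
  (n : ℝ)⁻¹ • sumProd x

lemma block_smul (t : ℝ) (Y : Matrix (Fin p) (Fin p) ℝ) (s : Finset (Fin p)) :
    block (t • Y) s = t • block Y s := rfl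

lemma isUnit_det_block_smul {t : ℝ} (ht : t ≠ 0) (Y : Matrix (Fin p) (Fin p) ℝ)
    (s : Finset (Fin p)) : IsUnit (block (t • Y) s).det ↔ IsUnit (block Y s).det := by
  rw [block_smul, Matrix.det_smul, isUnit_iff_ne_zero, isUnit_iff_ne_zero]
  simp [ht]

lemma score_smul {t : ℝ} (ht : t ≠ 0) (c : ℝ) (Y : Matrix (Fin p) (Fin p) ℝ) (γ : DAG p)
    (hdet : ∀ j, IsUnit (block Y (γ.parents j)).det) :
    score c (t • Y) γ = t * score c Y γ := by
  simp only [score, Finset.mul_sum]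
  refine Finset.sum_congr rfl fun j _ => ?_
  rw [explained_smul t ht Y _ j (hdet j), Matrix.smul_apply, smul_eq_mul]
  ring

lemma explained_nonneg {Y : Matrix (Fin p) (Fin p) ℝ} (hY : Y.PosSemidef) (s : Finset (Fin p))
    (j : Fin p) : 0 ≤ explained Y s j := by
  have h : (block Y s)⁻¹.PosSemidef := (hY.submatrix _).inv
  have := h.dotProduct_mulVec_nonneg (cross Y s j)
  simpa only [star_trivial, explained] using this

lemma explained_le {Y : Matrix (Fin p) (Fin p) ℝ} (hY : Y.PosSemidef) {s : Finset (Fin p)}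
    (hdet : IsUnit (block Y s).det) (j : Fin p) : explained Y s j ≤ Y j j := by
  have hS : Y.IsSymm := by simpa using hY.isHermitian
  have h := predError_inv hS hdet j
  rw [predError_eq_quadratic hS] at h
  have := hY.dotProduct_mulVec_nonneg
    (Pi.single j 1 - extend s ((block Y s)⁻¹ *ᵥ cross Y s j))
  simp only [star_trivial] at this
  linarith

lemma score_nonneg {Y : Matrix (Fin p) (Fin p) ℝ} (hY : Y.PosSemidef) {γ : DAG p}
    (hdet : ∀ j, IsUnit (block Y (γ.parents j)).det) {c : ℝ} (hc1 : c ≤ 1) :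
    0 ≤ score c Y γ := by
  refine Finset.sum_nonneg fun j _ => ?_
  have h1 := explained_le hY (hdet j) j
  have h2 := explained_nonneg hY (γ.parents j) j
  nlinarith

lemma div_one_add_le_one (n : ℕ) : (n : ℝ) / (1 + n) ≤ 1 := by
  rw [div_le_one (by positivity)]
  linarith

/-- The unnormalized posterior weight. -/
def weight (pr : PMF (DAG p)) (x : Fin n → Fin p → ℝ) (γ : DAG p) : ℝ :=
  (√(1 + n : ℝ))⁻¹ ^ γ.edges.card *
    (√(score ((n : ℝ) / (1 + n)) (sumProd x) γ))⁻¹ ^ (n * p) * (pr γ).toReal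

/-- The factor `scaleIntegral (n * p) 1` is common to all graphs and cancels in the posterior. -/
lemma evidence_mul_prior_eq (pr : PMF (DAG p)) (x : Fin n → Fin p → ℝ) (γ : DAG p)
    (hdet : ∀ j, IsUnit (gram x γ j).det)
    (hS : 0 < score ((n : ℝ) / (1 + n)) (sumProd x) γ) :
    evidence n x γ * pr γ = ENNReal.ofReal (weight pr x γ) * scaleIntegral (n * p) 1 := by
  rw [evidence_eq x γ (Nat.cast_nonneg n) hdet]
  have h := scaleIntegral_mul (n * p) 1 hS
  rw [mul_one] at h
  rw [h, weight, ENNReal.ofReal_mul (by positivity), ENNReal.ofReal_mul (by positivity),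
    ENNReal.ofReal_toReal (pr.apply_ne_top γ)]
  ring

/-- A vanishing score makes the evidence infinite, while positive scores make it a finite positive
multiple of the weight. The condition thus reduces to explicit functions of the second moments. -/
lemma posteriorDefined_iff (hn : 1 ≤ n) (hp : 1 ≤ p) (pr : PMF (DAG p)) (hpos : ∀ γ, pr γ ≠ 0)
    (x : Fin n → Fin p → ℝ) :
    PosteriorDefined n pr x ↔ (∀ (γ : DAG p) (j : Fin p), IsUnit (gram x γ j).det) ∧
      ∀ γ, 0 < score ((n : ℝ) / (1 + n)) (sumProd x) γ := by
  have hN : n * p ≠ 0 := by positivity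
  constructor
  · rintro ⟨hdet, -, hfin⟩
    refine ⟨hdet, fun γ => ?_⟩
    have hd : ∀ j, IsUnit (block (sumProd x) (γ.parents j)).det := fun j => by
      rw [← gram_eq_block]
      exact hdet γ j
    refine lt_of_le_of_ne (score_nonneg (sumProd_posSemidef x) hd (div_one_add_le_one n))
      fun h => hfin ?_
    have h1 : evidence n x γ * pr γ = ∞ := by
      rw [evidence_eq x γ (Nat.cast_nonneg n) (hdet γ), ← h, scaleIntegral_zero hN,
        ENNReal.mul_top, ENNReal.top_mul (hpos γ)]
      rw [ne_eq, ENNReal.ofReal_eq_zero, not_le]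
      positivity
    rw [totalEvidence, ← top_le_iff, ← h1]
    exact Finset.single_le_sum (f := fun γ => evidence n x γ * pr γ) (fun _ _ => zero_le)
      (Finset.mem_univ γ)
  · rintro ⟨hdet, hS⟩
    have hw : ∀ γ, 0 < weight pr x γ := fun γ => by
      have h1 := Real.sqrt_pos.2 (hS γ)
      have h2 := ENNReal.toReal_pos (hpos γ) (pr.apply_ne_top γ)
      rw [weight]
      positivity
    refine ⟨hdet, ?_, ?_⟩
    · intro h
      rw [totalEvidence, Finset.sum_eq_zero_iff] at h
      obtain ⟨γ, hγ⟩ : ∃ γ, pr γ ≠ 0 := by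
        obtain ⟨γ, hγ⟩ := pr.support_nonempty
        exact ⟨γ, hγ⟩
      have := h γ (Finset.mem_univ γ)
      rw [evidence_mul_prior_eq pr x γ (hdet γ) (hS γ)] at this
      rcases mul_eq_zero.1 this with h1 | h1
      · rw [ENNReal.ofReal_eq_zero] at h1
        exact absurd (hw γ) (not_lt.2 h1)
      · exact scaleIntegral_ne_zero _ _ h1
    · rw [totalEvidence]
      refine ENNReal.sum_ne_top.2 fun γ _ => ?_
      rw [evidence_mul_prior_eq pr x γ (hdet γ) (hS γ)]
      exact ENNReal.mul_ne_top ENNReal.ofReal_ne_top (scaleIntegral_one_ne_top hN)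

lemma posterior_le_one (g : ℝ) (pr : PMF (DAG p)) (x : Fin n → Fin p → ℝ) (γ : DAG p) :
    posterior g pr x γ ≤ 1 := by
  have h : evidence g x γ * pr γ ≤ totalEvidence g pr x :=
    Finset.single_le_sum (f := fun γ => evidence g x γ * pr γ) (fun _ _ => zero_le)
      (Finset.mem_univ γ)
  refine ENNReal.toReal_le_of_le_ofReal zero_le_one ?_
  rw [ENNReal.ofReal_one]
  exact ENNReal.div_le_of_le_mul (by rwa [one_mul])

lemma posterior_eq (hn : 1 ≤ n) (hp : 1 ≤ p) (pr : PMF (DAG p)) (hpos : ∀ γ, pr γ ≠ 0)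
    (x : Fin n → Fin p → ℝ) (hx : PosteriorDefined n pr x) (γ : DAG p) :
    posterior n pr x γ = weight pr x γ / ∑ γ', weight pr x γ' := by
  obtain ⟨hdet, hS⟩ := (posteriorDefined_iff hn hp pr hpos x).1 hx
  have hN : n * p ≠ 0 := by positivity
  have hw : ∀ γ, 0 ≤ weight pr x γ := fun γ => by
    rw [weight]
    positivity
  rw [posterior, totalEvidence]
  simp_rw [fun γ => evidence_mul_prior_eq pr x γ (hdet γ) (hS γ)]
  rw [← Finset.sum_mul, ENNReal.mul_div_mul_right _ _ (scaleIntegral_ne_zero _ _)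
    (scaleIntegral_one_ne_top hN), ENNReal.toReal_div,
    ENNReal.toReal_sum (fun _ _ => ENNReal.ofReal_ne_top), ENNReal.toReal_ofReal (hw γ)]
  simp_rw [fun γ => ENNReal.toReal_ofReal (hw γ)]

-- Keeping only the weight of `γs` in the denominator leaves the sum of the odds. Ratios of scores
-- do not change when the moments are divided by `n`, so convergent moments can be used.
open Classical in
lemma one_sub_posterior_le (hn : 1 ≤ n) (hp : 1 ≤ p) (pr : PMF (DAG p)) (hpos : ∀ γ, pr γ ≠ 0)
    {C : ℝ} (hprior : ∀ γ γ', (pr γ).toReal / (pr γ').toReal ≤ C)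
    (x : Fin n → Fin p → ℝ) (hx : PosteriorDefined n pr x) (γs : DAG p) :
    1 - posterior n pr x γs ≤ ∑ γ ∈ Finset.univ.filter (· ≠ γs),
      C * (√(1 + n : ℝ) ^ γs.edges.card * (√(1 + n : ℝ))⁻¹ ^ γ.edges.card) *
        Real.exp ((n * p : ℝ) / 2 * Real.log (score ((n : ℝ) / (1 + n)) (meanProd x) γs /
          score ((n : ℝ) / (1 + n)) (meanProd x) γ)) := by
  obtain ⟨hdet, hS⟩ := (posteriorDefined_iff hn hp pr hpos x).1 hx
  have hprt : ∀ γ, 0 < (pr γ).toReal := fun γ =>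
    ENNReal.toReal_pos (hpos γ) (pr.apply_ne_top γ)
  have hw : ∀ γ, 0 < weight pr x γ := fun γ => by
    have h1 := Real.sqrt_pos.2 (hS γ)
    have h2 := hprt γ
    rw [weight]
    positivity
  rw [posterior_eq hn hp pr hpos x hx]
  have hsum : ∑ γ, weight pr x γ =
      weight pr x γs + ∑ γ ∈ Finset.univ.filter (· ≠ γs), weight pr x γ := by
    rw [← Finset.add_sum_erase _ _ (Finset.mem_univ γs)]
    congr 1
    refine Finset.sum_congr ?_ fun _ _ => rfl
    ext γ
    simp
  have hR : 0 ≤ ∑ γ ∈ Finset.univ.filter (· ≠ γs), weight pr x γ :=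
    Finset.sum_nonneg fun γ _ => (hw γ).le
  have h1 : 1 - weight pr x γs / ∑ γ, weight pr x γ ≤
      ∑ γ ∈ Finset.univ.filter (· ≠ γs), weight pr x γ / weight pr x γs := by
    rw [hsum, ← Finset.sum_div, one_sub_div (by linarith [hw γs]), add_sub_cancel_left]
    exact div_le_div_of_nonneg_left hR (hw γs) (by linarith)
  refine h1.trans (Finset.sum_le_sum fun γ _ => ?_)
  have hn0 : (0 : ℝ) < n := by exact_mod_cast hn
  have hsc : ∀ γ, score ((n : ℝ) / (1 + n)) (meanProd x) γ =
      (n : ℝ)⁻¹ * score ((n : ℝ) / (1 + n)) (sumProd x) γ := by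
    intro γ
    refine score_smul (inv_ne_zero hn0.ne') _ _ γ fun j => ?_
    rw [← gram_eq_block]
    exact hdet γ j
  rw [hsc, hsc, mul_div_mul_left _ _ (inv_ne_zero hn0.ne')]
  set S := score ((n : ℝ) / (1 + n)) (sumProd x) γ with hSd
  set T := score ((n : ℝ) / (1 + n)) (sumProd x) γs with hTd
  have hS0 : 0 < S := hS γ
  have hT0 : 0 < T := hS γs
  have hexp : Real.exp ((n * p : ℝ) / 2 * Real.log (T / S)) =
      (√S)⁻¹ ^ (n * p) / (√T)⁻¹ ^ (n * p) := by
    rw [← div_pow, inv_div_inv, ← Real.sqrt_div hT0.le, Real.sqrt_eq_rpow, ← Real.rpow_natCast,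
      ← Real.rpow_mul (by positivity), Real.rpow_def_of_pos (by positivity)]
    congr 1
    push_cast
    ring
  have hq : (√(1 + n : ℝ)) ≠ 0 := (Real.sqrt_pos.2 (by positivity)).ne'
  have hst : √T ≠ 0 := (Real.sqrt_pos.2 hT0).ne'
  have hss : √S ≠ 0 := (Real.sqrt_pos.2 hS0).ne'
  have hweq : weight pr x γ / weight pr x γs =
      (pr γ).toReal / (pr γs).toReal *
        (√(1 + n : ℝ) ^ γs.edges.card * (√(1 + n : ℝ))⁻¹ ^ γ.edges.card) *
        Real.exp ((n * p : ℝ) / 2 * Real.log (T / S)) := by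
    have h3 := (hprt γs).ne'
    rw [hexp, weight, weight, ← hSd, ← hTd]
    simp only [inv_pow]
    field_simp
  rw [hweq]
  have := hprior γ γs
  gcongr

/-- The difference of the scores of a graph and a supergraph is at most the size of the projection
of the noise on the parents in the supergraph. -/
lemma score_sub_score_le {Y : Matrix (Fin p) (Fin p) ℝ} (hY : Y.PosSemidef) {γ γs : DAG p}
    (hsub : γs.edges ⊆ γ.edges)
    (hdet : ∀ j, IsUnit (block Y (γ.parents j)).det)
    (hdets : ∀ j, IsUnit (block Y (γs.parents j)).det)
    (b : (j : Fin p) → γs.parents j → ℝ) {c : ℝ} (hc0 : 0 ≤ c) (hc1 : c ≤ 1)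
    (u : (j : Fin p) → γ.parents j → ℝ)
    (hu : ∀ j k, u j k = Y k j - ∑ l : γs.parents j, b j l * Y k l) :
    score c Y γs - score c Y γ ≤ ∑ j, u j ⬝ᵥ (block Y (γ.parents j))⁻¹ *ᵥ u j := by
  have hS : Y.IsSymm := by simpa using hY.isHermitian
  rw [score, score, ← Finset.sum_sub_distrib]
  refine Finset.sum_le_sum fun j _ => ?_
  have hpar : γs.parents j ⊆ γ.parents j := by
    intro k hk
    rw [DAG.mem_parents] at hk ⊢
    exact hsub hk
  -- The coefficients `b` are reread on the larger parent set. The prediction error is unchanged,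
  -- and the square completed there has `u` as its remainder.
  set b' : γ.parents j → ℝ := fun k => extend (γs.parents j) (b j) k with hb'
  have hext : extend (γ.parents j) b' = extend (γs.parents j) (b j) := by
    funext k
    by_cases hk : k ∈ γ.parents j
    · simp [extend, hk, hb']
    · have : k ∉ γs.parents j := fun h => hk (hpar h)
      simp [extend, hk, this]
  have h1 := sub_explained_le_predError hY (hdets j) j (b j)
  rw [predError_eq_quadratic hS, ← hext, ← predError_eq_quadratic hS, predError_eq hS (hdet j)]
    at h1
  have hv : cross Y (γ.parents j) j - block Y (γ.parents j) *ᵥ b' = u j := by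
    funext k
    rw [hu, Pi.sub_apply, cross]
    congr 1
    rw [← sum_extend (γs.parents j) (b j) (fun l => Y k l), ← hext, sum_extend]
    simp only [Matrix.mulVec, dotProduct, block, Matrix.submatrix_apply]
    exact Finset.sum_congr rfl fun _ _ => mul_comm _ _
  rw [hv] at h1
  have h2 : (block Y (γ.parents j))⁻¹.PosSemidef := (hY.submatrix _).inv
  have h3 := h2.dotProduct_mulVec_nonneg (u j)
  simp only [star_trivial] at h3
  -- The gain in explained part is at most the projection term; as that term is nonnegative, the
  -- factor `c ∈ [0, 1]` preserves the bound.
  nlinarith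

/-- An additional edge would join two nodes that are already joined, hence repeat an edge or close a
cycle of length two. -/
lemma DAG.eq_of_isComplete {γs γ : DAG p} (hc : γs.IsComplete) (hsub : γs.edges ⊆ γ.edges) :
    γ = γs := by
  refine DAG.ext (Finset.Subset.antisymm ?_ hsub)
  rintro ⟨j, k⟩ h
  have hne : j ≠ k := by
    rintro rfl
    exact γ.acyclic j (Relation.TransGen.single h)
  rcases hc j k hne with h1 | h1
  · exact h1
  · exact absurd ((Relation.TransGen.single h).tail (hsub h1)) (γ.acyclic j)

lemma sqrt_pow_mul_inv_pow_le (n k : ℕ) (l : ℕ) :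
    √(1 + n : ℝ) ^ k * (√(1 + n : ℝ))⁻¹ ^ l ≤ (1 + (n : ℝ)) ^ ((k : ℝ) / 2) := by
  have h1 : (1 : ℝ) ≤ √(1 + n : ℝ) := Real.one_le_sqrt.2 (by simp)
  have h2 : (√(1 + n : ℝ))⁻¹ ^ l ≤ 1 := pow_le_one₀ (by positivity) (inv_le_one_of_one_le₀ h1)
  have h3 : √(1 + n : ℝ) ^ k = (1 + (n : ℝ)) ^ ((k : ℝ) / 2) := by
    rw [Real.sqrt_eq_rpow, ← Real.rpow_natCast, ← Real.rpow_mul (by positivity)]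
    congr 1
    ring
  rw [← h3]
  exact mul_le_of_le_one_right (by positivity) h2

lemma sqrt_pow_mul_inv_pow_le_of_lt {n k l : ℕ} (hn : 1 ≤ n) (hkl : k < l) :
    √(1 + n : ℝ) ^ k * (√(1 + n : ℝ))⁻¹ ^ l ≤ 1 / √(n : ℝ) := by
  have hn0 : (0 : ℝ) < n := by exact_mod_cast hn
  have h1 : (1 : ℝ) ≤ √(1 + n : ℝ) := Real.one_le_sqrt.2 (by simp)
  have h0 : √(1 + n : ℝ) ≠ 0 := by positivity
  obtain ⟨d, rfl⟩ := Nat.exists_eq_add_of_lt hkl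
  have h2 : √(1 + n : ℝ) ^ k * (√(1 + n : ℝ))⁻¹ ^ (k + d + 1) =
      (√(1 + n : ℝ))⁻¹ ^ d * (√(1 + n : ℝ))⁻¹ := by
    rw [pow_succ, pow_add, ← mul_assoc, ← mul_assoc, ← mul_pow, mul_inv_cancel₀ h0, one_pow,
      one_mul]
  rw [h2, one_div]
  have h3 : (√(1 + n : ℝ))⁻¹ ^ d ≤ 1 := pow_le_one₀ (by positivity) (inv_le_one_of_one_le₀ h1)
  refine (mul_le_of_le_one_left (by positivity) h3).trans ?_
  exact inv_anti₀ (Real.sqrt_pos.2 hn0) (Real.sqrt_le_sqrt (by linarith))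

end PosteriorBounds

-- Continuity and measurability of the scores in the moment matrix

section MatrixFunctions

variable {m : Type*} [Fintype m] [DecidableEq m]

lemma tendsto_matrix_inv {α : Type*} {l : Filter α} {Y : α → Matrix m m ℝ} {L : Matrix m m ℝ}
    (hL : IsUnit L.det) (hY : Tendsto Y l (𝓝 L)) : Tendsto (fun a => (Y a)⁻¹) l (𝓝 L⁻¹) := by
  have hdet : Tendsto (fun a => (Y a).det) l (𝓝 L.det) :=
    ((continuous_id.matrix_det).tendsto L).comp hY
  have hadj : Tendsto (fun a => (Y a).adjugate) l (𝓝 L.adjugate) :=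
    ((continuous_id.matrix_adjugate).tendsto L).comp hY
  simp only [Matrix.inv_def, Ring.inverse_eq_inv']
  exact (hdet.inv₀ hL.ne_zero).smul hadj

variable {Ω : Type*} [MeasurableSpace Ω]

lemma measurable_det {Y : Ω → Matrix m m ℝ} (hY : ∀ i j, Measurable fun ω => Y ω i j) :
    Measurable fun ω => (Y ω).det := by
  simp only [Matrix.det_apply]
  exact Finset.measurable_sum _ fun σ _ =>
    (Finset.measurable_prod _ fun i _ => hY _ _).const_smul _

lemma measurable_inv_apply {Y : Ω → Matrix m m ℝ} (hY : ∀ i j, Measurable fun ω => Y ω i j)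
    (i j : m) : Measurable fun ω => (Y ω)⁻¹ i j := by
  simp only [Matrix.inv_def, Ring.inverse_eq_inv', Matrix.smul_apply, Matrix.adjugate_apply,
    smul_eq_mul]
  refine (measurable_det hY).inv.mul (measurable_det fun a b => ?_)
  simp only [Matrix.updateRow_apply]
  split_ifs
  · exact measurable_const
  · exact hY a b

lemma measurable_dotProduct_inv_mulVec {Y : Ω → Matrix m m ℝ}
    (hY : ∀ i j, Measurable fun ω => Y ω i j) {u : Ω → m → ℝ}
    (hu : ∀ i, Measurable fun ω => u ω i) :
    Measurable fun ω => u ω ⬝ᵥ (Y ω)⁻¹ *ᵥ u ω := by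
  simp only [dotProduct, Matrix.mulVec]
  refine Finset.measurable_sum _ fun i _ => (hu i).mul ?_
  exact Finset.measurable_sum _ fun j _ => (measurable_inv_apply hY i j).mul (hu j)

variable {p : ℕ}

lemma measurable_score (c : ℝ) {Y : Ω → Matrix (Fin p) (Fin p) ℝ}
    (hY : ∀ i j, Measurable fun ω => Y ω i j) (γ : DAG p) :
    Measurable fun ω => score c (Y ω) γ := by
  refine Finset.measurable_sum _ fun j _ => (hY j j).sub (Measurable.const_mul ?_ c)
  exact measurable_dotProduct_inv_mulVec (Y := fun ω => block (Y ω) (γ.parents j))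
    (fun _ _ => hY _ _) (fun _ => hY _ _)

lemma tendsto_block {α : Type*} {l : Filter α} {Y : α → Matrix (Fin p) (Fin p) ℝ}
    {L : Matrix (Fin p) (Fin p) ℝ} (hY : Tendsto Y l (𝓝 L)) (s : Finset (Fin p)) :
    Tendsto (fun a => block (Y a) s) l (𝓝 (block L s)) :=
  ((continuous_id.matrix_submatrix _ _).tendsto L).comp hY

lemma tendsto_score {α : Type*} {l : Filter α} {c : α → ℝ} {c₀ : ℝ}
    {Y : α → Matrix (Fin p) (Fin p) ℝ} {L : Matrix (Fin p) (Fin p) ℝ}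
    (hc : Tendsto c l (𝓝 c₀)) (hY : Tendsto Y l (𝓝 L)) (γ : DAG p)
    (hL : ∀ j, IsUnit (block L (γ.parents j)).det) :
    Tendsto (fun a => score (c a) (Y a) γ) l (𝓝 (score c₀ L γ)) := by
  have hent : ∀ i j, Tendsto (fun a => Y a i j) l (𝓝 (L i j)) := fun i j =>
    tendsto_pi_nhds.1 (tendsto_pi_nhds.1 hY i) j
  refine tendsto_finsetSum _ fun j _ => (hent j j).sub (hc.mul ?_)
  have hinv := tendsto_matrix_inv (hL j) (tendsto_block hY (γ.parents j))
  simp only [explained, dotProduct, Matrix.mulVec]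
  refine tendsto_finsetSum _ fun i _ => (hent i j).mul (tendsto_finsetSum _ fun k _ => ?_)
  exact (tendsto_pi_nhds.1 (tendsto_pi_nhds.1 hinv i) k).mul (hent k j)

end MatrixFunctions

-- Calculus of stochastic orders

section StochasticOrder

variable {Ω : Type*} [MeasurableSpace Ω] {P : Measure Ω}

lemma IsBigOp.add {A B : ℕ → Ω → ℝ} (hA : IsBigOp P A) (hB : IsBigOp P B) :
    IsBigOp P fun n ω => A n ω + B n ω := by
  refine ⟨fun n => (hA.1 n).add (hB.1 n), fun η hη => ?_⟩
  obtain ⟨M, hM⟩ := hA.2 (η / 2) (by positivity)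
  obtain ⟨N, hN⟩ := hB.2 (η / 2) (by positivity)
  refine ⟨M + N, ?_⟩
  filter_upwards [hM, hN] with n h1 h2
  calc P {ω | M + N < |A n ω + B n ω|}
      ≤ P ({ω | M < |A n ω|} ∪ {ω | N < |B n ω|}) := by
        refine measure_mono fun ω hω => ?_
        by_contra hc
        simp only [Set.mem_union, Set.mem_ofPred_eq, not_or, not_lt] at hc hω
        linarith [abs_add_le (A n ω) (B n ω)]
    _ ≤ _ := measure_union_le _ _
    _ ≤ ENNReal.ofReal (η / 2) + ENNReal.ofReal (η / 2) := add_le_add h1 h2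
    _ = ENNReal.ofReal η := by
        rw [← ENNReal.ofReal_add (by positivity) (by positivity), add_halves]

lemma IsBigOp.mul {A B : ℕ → Ω → ℝ} (hA : IsBigOp P A) (hB : IsBigOp P B) :
    IsBigOp P fun n ω => A n ω * B n ω := by
  refine ⟨fun n => (hA.1 n).mul (hB.1 n), fun η hη => ?_⟩
  obtain ⟨M, hM⟩ := hA.2 (η / 2) (by positivity)
  obtain ⟨N, hN⟩ := hB.2 (η / 2) (by positivity)
  refine ⟨M * N, ?_⟩
  filter_upwards [hM, hN] with n h1 h2
  calc P {ω | M * N < |A n ω * B n ω|}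
      ≤ P ({ω | M < |A n ω|} ∪ {ω | N < |B n ω|}) := by
        refine measure_mono fun ω hω => ?_
        by_contra hc
        simp only [Set.mem_union, Set.mem_ofPred_eq, not_or, not_lt] at hc hω
        rw [abs_mul] at hω
        have := mul_le_mul hc.1 hc.2 (abs_nonneg _) ((abs_nonneg _).trans hc.1)
        linarith
    _ ≤ _ := measure_union_le _ _
    _ ≤ ENNReal.ofReal (η / 2) + ENNReal.ofReal (η / 2) := add_le_add h1 h2
    _ = ENNReal.ofReal η := by
        rw [← ENNReal.ofReal_add (by positivity) (by positivity), add_halves]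

lemma isBigOp_const (c : ℝ) : IsBigOp P fun _ _ => c := by
  refine ⟨fun n => measurable_const, fun η _ => ⟨|c|, ?_⟩⟩
  simp

lemma isBigOp_sum {ι : Type*} (s : Finset ι) {A : ι → ℕ → Ω → ℝ}
    (hA : ∀ i ∈ s, IsBigOp P (A i)) : IsBigOp P fun n ω => ∑ i ∈ s, A i n ω := by
  classical
  induction s using Finset.induction_on with
  | empty => simpa using isBigOp_const (P := P) 0
  | insert i s hi ih =>
    simp only [Finset.sum_insert hi]
    exact (hA i (Finset.mem_insert_self _ _)).add
      (ih fun k hk => hA k (Finset.mem_insert_of_mem hk))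

lemma IsBigOp.abs {A : ℕ → Ω → ℝ} (hA : IsBigOp P A) : IsBigOp P fun n ω => |A n ω| := by
  refine ⟨fun n => (hA.1 n).abs, ?_⟩
  simpa only [abs_abs] using hA.2

lemma isBigOp_of_tendsto_ae [IsFiniteMeasure P] {A : ℕ → Ω → ℝ} (hm : ∀ n, Measurable (A n))
    {c : ℝ} (h : ∀ᵐ ω ∂P, Tendsto (fun n => A n ω) atTop (𝓝 c)) : IsBigOp P A := by
  have h1 := tendstoInMeasure_of_tendsto_ae (fun n => (hm n).aestronglyMeasurable) h
  refine ⟨hm, fun η hη => ⟨|c| + 1, ?_⟩⟩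
  have h2 := tendstoInMeasure_iff_dist.1 h1 1 one_pos
  have h3 := h2.eventually (Iic_mem_nhds (ENNReal.ofReal_pos.2 hη))
  filter_upwards [h3] with n hn
  refine (measure_mono fun ω hω => ?_).trans hn
  simp only [Set.mem_ofPred_eq, Real.dist_eq] at hω ⊢
  have := abs_sub_abs_le_abs_sub (A n ω) c
  linarith

lemma isBigOp_of_variance_le [IsProbabilityMeasure P] {A : ℕ → Ω → ℝ}
    (hm : ∀ n, Measurable (A n)) (h2 : ∀ n, MemLp (A n) 2 P) (h0 : ∀ n, ∫ ω, A n ω ∂P = 0)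
    {v : ℝ} (hv : ∀ n, variance (A n) P ≤ v) : IsBigOp P A := by
  have hv0 : 0 ≤ v := (variance_nonneg _ _).trans (hv 0)
  -- Chebyshev's inequality at this level gives at most `η`; the added `1` keeps the level positive
  -- when `v = 0`.
  refine ⟨hm, fun η hη => ⟨√(v / η) + 1, Eventually.of_forall fun n => ?_⟩⟩
  have hM : 0 < √(v / η) + 1 := by positivity
  have h := meas_ge_le_variance_div_sq (h2 n) hM
  rw [h0] at h
  simp only [sub_zero] at h
  refine (measure_mono fun ω hω => ?_).trans (h.trans (ENNReal.ofReal_le_ofReal ?_))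
  · simp only [Set.mem_ofPred_eq] at hω ⊢
    exact hω.le
  · rw [div_le_iff₀ (by positivity)]
    have h3 : v / η ≤ (√(v / η) + 1) ^ 2 := by
      have := Real.sq_sqrt (show 0 ≤ v / η by positivity)
      nlinarith [Real.sqrt_nonneg (v / η)]
    rw [div_le_iff₀ hη] at h3
    linarith [hv n]

lemma isLittleOp_of_tendsto_ae [IsFiniteMeasure P] {A : ℕ → Ω → ℝ} (hm : ∀ n, Measurable (A n))
    (h : ∀ᵐ ω ∂P, Tendsto (fun n => A n ω) atTop (𝓝 0)) : IsLittleOp P A :=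
  ⟨hm, tendstoInMeasure_of_tendsto_ae (fun n => (hm n).aestronglyMeasurable) h⟩

lemma tendsto_measure_of_ae_eventually [IsProbabilityMeasure P] {s : ℕ → Set Ω}
    (hs : ∀ n, MeasurableSet (s n)) (h : ∀ᵐ ω ∂P, ∀ᶠ n in atTop, ω ∈ s n) :
    Tendsto (fun n => P (s n)) atTop (𝓝 1) := by
  have := tendsto_measure_of_ae_tendsto_indicator_of_isFiniteMeasure (μ := P) (As := s) atTop
    MeasurableSet.univ hs (by
      filter_upwards [h] with ω hω
      filter_upwards [hω] with n hn
      simp [hn])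
  simpa using this

end StochasticOrder

-- Population risks and identifiability of the true graph

section Population

variable {p : ℕ} {γs : DAG p}

/-- The coefficient matrix of a linear structural equation model. -/
def coeffMatrix (γ : DAG p) (b : (j : Fin p) → γ.parents j → ℝ) : Matrix (Fin p) (Fin p) ℝ :=
  Matrix.of fun j => extend (γ.parents j) (b j)

lemma rank_lt_of_coeffMatrix_ne_zero {γ : DAG p} {b : (j : Fin p) → γ.parents j → ℝ}
    {j k : Fin p} (h : coeffMatrix γ b j k ≠ 0) : γ.rank k < γ.rank j := by
  refine γ.rank_lt (γ.mem_parents.1 ?_)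
  by_contra hk
  simp [coeffMatrix, extend, hk] at h

lemma det_one_sub_coeffMatrix (γ : DAG p) (b : (j : Fin p) → γ.parents j → ℝ) :
    (1 - coeffMatrix γ b).det = 1 :=
  det_one_sub_eq_one_of_rank γ.rank fun _ _ => rank_lt_of_coeffMatrix_ne_zero

/-- The matrix that expresses the variables in terms of the errors. -/
def totalEffects (γ : DAG p) (b : (j : Fin p) → γ.parents j → ℝ) : Matrix (Fin p) (Fin p) ℝ :=
  (1 - coeffMatrix γ b)⁻¹

lemma isUnit_det_one_sub (γ : DAG p) (b : (j : Fin p) → γ.parents j → ℝ) :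
    IsUnit (1 - coeffMatrix γ b).det := by
  rw [det_one_sub_coeffMatrix]
  exact isUnit_one

lemma totalEffects_mul (γ : DAG p) (b : (j : Fin p) → γ.parents j → ℝ) :
    totalEffects γ b * (1 - coeffMatrix γ b) = 1 :=
  Matrix.nonsing_inv_mul _ (isUnit_det_one_sub γ b)

lemma mul_totalEffects (γ : DAG p) (b : (j : Fin p) → γ.parents j → ℝ) :
    (1 - coeffMatrix γ b) * totalEffects γ b = 1 :=
  Matrix.mul_nonsing_inv _ (isUnit_det_one_sub γ b)

lemma det_totalEffects (γ : DAG p) (b : (j : Fin p) → γ.parents j → ℝ) :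
    (totalEffects γ b).det = 1 := by
  have h := congrArg Matrix.det (totalEffects_mul γ b)
  rwa [Matrix.det_mul, det_one_sub_coeffMatrix, mul_one, Matrix.det_one] at h

/-- A parent in a supergraph is not affected by the error of its child. -/
lemma totalEffects_eq_zero {γ : DAG p} (hsub : γs.edges ⊆ γ.edges)
    (b : (j : Fin p) → γs.parents j → ℝ) (j : Fin p) :
    ∀ N k, γ.rank k = N → γ.rank k < γ.rank j → totalEffects γs b k j = 0 := by
  intro N
  -- Row `k` of `T = 1 + B T` expresses `T k j` through the entries `T l j` of the parents `l` of
  -- `k`. Ranks are taken in the supergraph, whose order also fits `γs` and places the parents of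
  -- `j` in `γ` before `j`.
  induction N using Nat.strong_induction_on with
  | _ N ih =>
  intro k hk hkj
  have h := congrFun (congrFun (mul_totalEffects γs b) k) j
  have hne : k ≠ j := by rintro rfl; exact lt_irrefl _ hkj
  rw [Matrix.sub_mul, Matrix.one_mul, Matrix.sub_apply, Matrix.one_apply_ne hne,
    Matrix.mul_apply, Finset.sum_eq_zero, sub_zero] at h
  · exact h
  · intro l _
    by_cases hl : l ∈ γs.parents k
    · have hlk := γ.rank_lt (hsub (γs.mem_parents.1 hl))
      rw [ih _ (by omega) l rfl (by omega), mul_zero]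
    · simp [coeffMatrix, extend, hl]

/-- The matrix of the second moments of the variables of the true model. -/
def popMoment (γ : DAG p) (b : (j : Fin p) → γ.parents j → ℝ) (σ : ℝ) :
    Matrix (Fin p) (Fin p) ℝ :=
  σ ^ 2 • (totalEffects γ b * (totalEffects γ b)ᵀ)

lemma popMoment_posDef (γ : DAG p) (b : (j : Fin p) → γ.parents j → ℝ) {σ : ℝ} (hσ : 0 < σ) :
    (popMoment γ b σ).PosDef := by
  refine Matrix.PosDef.smul ?_ (by positivity)
  have h : Function.Injective (totalEffects γ b).vecMul := by
    refine Matrix.vecMul_injective_of_isUnit ?_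
    rw [Matrix.isUnit_iff_isUnit_det, det_totalEffects]
    exact isUnit_one
  simpa using Matrix.PosDef.mul_conjTranspose_self _ h

lemma isUnit_det_block {Y : Matrix (Fin p) (Fin p) ℝ} (hY : Y.PosDef) (s : Finset (Fin p)) :
    IsUnit (block Y s).det :=
  (hY.submatrix Subtype.val_injective).det_pos.ne'.isUnit

/-- The coefficients of the best linear prediction of the nodes from their parents. -/
def bestCoeff (Y : Matrix (Fin p) (Fin p) ℝ) (γ : DAG p) : (j : Fin p) → γ.parents j → ℝ :=
  fun j => (block Y (γ.parents j))⁻¹ *ᵥ cross Y (γ.parents j) j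

/-- The residual of node `j` has row `j` of `1 - W` as its coefficients, so the mean squared
residuals are the diagonal of `(1 - W) Σ (1 - W)ᵀ`. -/
lemma score_popMoment_eq_trace (γ : DAG p) (b : (j : Fin p) → γs.parents j → ℝ) {σ : ℝ}
    (hσ : 0 < σ) :
    score 1 (popMoment γs b σ) γ = σ ^ 2 *
      (((1 - coeffMatrix γ (bestCoeff (popMoment γs b σ) γ)) * totalEffects γs b) *
      ((1 - coeffMatrix γ (bestCoeff (popMoment γs b σ) γ)) * totalEffects γs b)ᵀ).trace := by
  have hpd := popMoment_posDef γs b hσ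
  have hS : (popMoment γs b σ).IsSymm := by simpa using hpd.isHermitian
  set W := coeffMatrix γ (bestCoeff (popMoment γs b σ) γ) with hW
  have h1 : ((1 - W) * totalEffects γs b) * ((1 - W) * totalEffects γs b)ᵀ =
      (1 - W) * (totalEffects γs b * (totalEffects γs b)ᵀ) * (1 - W)ᵀ := by
    rw [Matrix.transpose_mul]
    simp only [Matrix.mul_assoc]
  have h2 : σ ^ 2 * ((1 - W) * (totalEffects γs b * (totalEffects γs b)ᵀ) * (1 - W)ᵀ).trace =
      ((1 - W) * popMoment γs b σ * (1 - W)ᵀ).trace := by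
    rw [popMoment, Matrix.mul_smul, Matrix.smul_mul, Matrix.trace_smul, smul_eq_mul]
  rw [h1, h2, score, Matrix.trace]
  refine Finset.sum_congr rfl fun j _ => ?_
  have h3 := predError_inv hS (isUnit_det_block hpd (γ.parents j)) j
  rw [one_mul, ← h3, predError_eq_quadratic hS]
  have h4 : (Pi.single j 1 - extend (γ.parents j)
      ((block (popMoment γs b σ) (γ.parents j))⁻¹ *ᵥ cross (popMoment γs b σ) (γ.parents j) j)) =
      (1 - W) j := by
    funext k
    simp [hW, coeffMatrix, bestCoeff, Matrix.one_apply, Pi.single_apply, eq_comm]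
  rw [h4, Matrix.diag_apply, Matrix.mul_assoc, Matrix.mul_apply]
  simp only [dotProduct, Matrix.mulVec, Matrix.mul_apply, Matrix.transpose_apply]

/-- The matrix `M` maps errors to residuals and has determinant one, so a trace of at most `p` makes
it orthogonal. Then `1 - W = M (1 - B)` has the same Gram matrix as `1 - B`, whence `W = B`, and an
edge missing from `γ` would be a zero true coefficient. -/
lemma subset_of_score_popMoment_le (γ : DAG p) (b : (j : Fin p) → γs.parents j → ℝ)
    (hb : ∀ j k, b j k ≠ 0) {σ : ℝ} (hσ : 0 < σ)
    (h : score 1 (popMoment γs b σ) γ ≤ p * σ ^ 2) :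
    γs.edges ⊆ γ.edges ∧ score 1 (popMoment γs b σ) γ = p * σ ^ 2 := by
  rw [score_popMoment_eq_trace γ b hσ] at h ⊢
  set W := coeffMatrix γ (bestCoeff (popMoment γs b σ) γ) with hW
  set M := (1 - W) * totalEffects γs b with hM
  have hdet : M.det = 1 := by
    rw [hM, Matrix.det_mul, det_totalEffects, hW, det_one_sub_coeffMatrix, one_mul]
  have hσ2 : 0 < σ ^ 2 := by positivity
  have htr : (M * Mᵀ).trace ≤ Fintype.card (Fin p) := by
    rw [Fintype.card_fin]
    rw [mul_comm (p : ℝ)] at h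
    exact le_of_mul_le_mul_left h hσ2
  have hMM := mul_transpose_eq_one_of_trace_le hdet htr
  refine ⟨?_, by rw [hMM, Matrix.trace_one, Fintype.card_fin, mul_comm]⟩
  have hMM' : Mᵀ * M = 1 := mul_eq_one_comm.1 hMM
  set B := coeffMatrix γs b with hB
  have h1 : 1 - W = M * (1 - B) := by
    rw [hM, Matrix.mul_assoc, hB, totalEffects_mul, Matrix.mul_one]
  have h2 : (1 - W)ᵀ * (1 - W) = (1 - B)ᵀ * (1 - B) := by
    rw [h1, Matrix.transpose_mul, Matrix.mul_assoc, ← Matrix.mul_assoc Mᵀ, hMM', Matrix.one_mul]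
  have hWB : W = B := by
    refine eq_of_transpose_mul_self_eq γ.rank (fun _ _ => rank_lt_of_coeffMatrix_ne_zero)
      (fun j => ?_) h2
    by_contra hj
    exact lt_irrefl _ (rank_lt_of_coeffMatrix_ne_zero hj)
  rintro ⟨k, j⟩ hkj
  rw [← DAG.mem_parents] at hkj ⊢
  by_contra hk
  have h3 : W j k = 0 := by simp [hW, coeffMatrix, extend, hk]
  rw [hWB] at h3
  have h4 : B j k = b j ⟨k, hkj⟩ := by simp [hB, coeffMatrix, extend, hkj]
  exact hb j ⟨k, hkj⟩ (h4 ▸ h3)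

lemma le_score_popMoment (γ : DAG p) (b : (j : Fin p) → γs.parents j → ℝ)
    (hb : ∀ j k, b j k ≠ 0) {σ : ℝ} (hσ : 0 < σ) :
    p * σ ^ 2 ≤ score 1 (popMoment γs b σ) γ := by
  by_contra h
  exact absurd (subset_of_score_popMoment_le γ b hb hσ (not_le.1 h).le).2 (not_le.1 h).ne

end Population

-- Moments of the true model, the strong law and the noise

section Sample

variable {Ω : Type*} [MeasurableSpace Ω] {P : Measure Ω}
  {p : ℕ} {γs : DAG p} {β : (j : Fin p) → γs.parents j → ℝ} {ν : Fin p → Measure ℝ} {σ : ℝ}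
  {ε X : ℕ → Ω → Fin p → ℝ}

namespace IsSample

variable (hX : IsSample P γs β ν σ ε X)
include hX

lemma obs_eq (i : ℕ) (ω : Ω) : X i ω = totalEffects γs β *ᵥ ε i ω := by
  have h : (1 - coeffMatrix γs β) *ᵥ X i ω = ε i ω := by
    funext j
    have h1 := hX.structural_eq i ω j
    have h2 := sum_extend (γs.parents j) (β j) (X i ω)
    rw [Matrix.sub_mulVec, Matrix.one_mulVec, Pi.sub_apply]
    simp only [Matrix.mulVec, dotProduct, coeffMatrix, Matrix.of_apply]
    simp only [mul_comm] at h1 h2 ⊢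
    linarith
  rw [← h, Matrix.mulVec_mulVec, totalEffects_mul, Matrix.one_mulVec]

lemma measurable_error_apply (i : ℕ) (j : Fin p) : Measurable fun ω => ε i ω j :=
  (measurable_pi_apply j).comp (hX.measurable_error i)

lemma measurable_obs_apply (i : ℕ) (j : Fin p) : Measurable fun ω => X i ω j :=
  (measurable_pi_apply j).comp (hX.measurable_obs i)

lemma memLp_error_apply (i : ℕ) (j : Fin p) : MemLp (fun ω => ε i ω j) 2 P := by
  have h := hX.memLp_error j
  have hl := hX.law_error i j
  rw [← hl.map_eq] at h
  exact (memLp_map_measure_iff h.1 hl.aemeasurable).1 h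

lemma memLp_obs_apply (i : ℕ) (j : Fin p) : MemLp (fun ω => X i ω j) 2 P := by
  have h : (fun ω => X i ω j) = fun ω => ∑ a, totalEffects γs β j a * ε i ω a := by
    funext ω
    rw [hX.obs_eq]
    rfl
  rw [h]
  exact memLp_finsetSum _ fun a _ => (hX.memLp_error_apply i a).const_mul _

lemma integral_error (i : ℕ) (j : Fin p) : ∫ ω, ε i ω j ∂P = 0 := by
  rw [(hX.law_error i j).integral_eq]
  exact hX.mean_error j

lemma indepFun_error (i : ℕ) {j k : Fin p} (hjk : j ≠ k) :
    IndepFun (fun ω => ε i ω j) (fun ω => ε i ω k) P :=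
  hX.indep_error.indepFun (i := (i, j)) (j := (i, k)) (by simpa using hjk)

lemma identDistrib_error (i : ℕ) : IdentDistrib (ε i) (ε 0) P P := by
  have hlaw : ∀ r, HasLaw (fun ω j => ε r ω j) (Measure.pi ν) P := by
    intro r
    have hi : iIndepFun (fun j ω => ε r ω j) P :=
      hX.indep_error.precomp (g := fun j => (r, j)) (fun a c h => by simpa using h)
    exact hi.hasLaw_pi fun j => hX.law_error r j
  exact ⟨(hX.measurable_error i).aemeasurable, (hX.measurable_error 0).aemeasurable,
    (hlaw i).map_eq.trans (hlaw 0).map_eq.symm⟩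

lemma integrable_error_mul (i : ℕ) (j k : Fin p) :
    Integrable (fun ω => ε i ω j * ε i ω k) P :=
  (hX.memLp_error_apply i j).integrable_mul (hX.memLp_error_apply i k)

lemma integrable_obs_mul (i : ℕ) (j k : Fin p) :
    Integrable (fun ω => X i ω j * X i ω k) P :=
  (hX.memLp_obs_apply i j).integrable_mul (hX.memLp_obs_apply i k)

lemma indepFun_error_vector {i k : ℕ} (hik : i ≠ k) : IndepFun (ε i) (ε k) P := by
  classical
  have hm : ∀ q : ℕ × Fin p, Measurable fun ω => ε q.1 ω q.2 := fun q =>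
    hX.measurable_error_apply q.1 q.2
  have h := hX.indep_error.indepFun_finset (Finset.univ.image fun j => (i, j))
    (Finset.univ.image fun j => (k, j)) (by
      rw [Finset.disjoint_left]
      intro q h1 h2
      simp only [Finset.mem_image, Finset.mem_univ, true_and] at h1 h2
      obtain ⟨a, rfl⟩ := h1
      obtain ⟨c, hc⟩ := h2
      exact hik (congrArg Prod.fst hc).symm) hm
  have hf : ∀ r : ℕ, Measurable fun (v : (Finset.univ.image fun j : Fin p => (r, j)) → ℝ)
      (j : Fin p) => v ⟨(r, j), Finset.mem_image_of_mem _ (Finset.mem_univ j)⟩ := fun r =>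
    measurable_pi_lambda _ fun j => measurable_pi_apply _
  exact h.comp (hf i) (hf k)

lemma measurable_meanProd (n : ℕ) (k l : Fin p) :
    Measurable fun ω => meanProd (data X n ω) k l := by
  simp only [meanProd, Matrix.smul_apply, sumProd_apply, data, smul_eq_mul]
  exact (Finset.measurable_sum Finset.univ (f := fun (i : Fin n) ω => X i ω k * X i ω l)
    fun i _ => (hX.measurable_obs_apply i k).mul (hX.measurable_obs_apply i l)).const_mul _

variable [IsProbabilityMeasure P]

lemma integral_error_mul (i : ℕ) (j k : Fin p) :
    ∫ ω, ε i ω j * ε i ω k ∂P = σ ^ 2 * (1 : Matrix (Fin p) (Fin p) ℝ) j k := by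
  rcases eq_or_ne j k with rfl | hjk
  · have h1 := (hX.law_error i j).variance_eq
    rw [hX.var_error, variance_eq_sub (hX.memLp_error_apply i j), hX.integral_error] at h1
    rw [Matrix.one_apply_eq, mul_one, ← h1]
    simp [pow_two]
  · rw [(hX.indepFun_error i hjk).integral_fun_mul_eq_mul_integral
      (hX.measurable_error_apply i j).aestronglyMeasurable
      (hX.measurable_error_apply i k).aestronglyMeasurable, hX.integral_error,
      Matrix.one_apply_ne hjk]
    simp

lemma integral_obs_mul (i : ℕ) (k l : Fin p) :
    ∫ ω, X i ω k * X i ω l ∂P = popMoment γs β σ k l := by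
  have h : ∀ ω, X i ω k * X i ω l = ∑ a, ∑ c,
      totalEffects γs β k a * totalEffects γs β l c * (ε i ω a * ε i ω c) := by
    intro ω
    rw [hX.obs_eq]
    simp only [Matrix.mulVec, dotProduct]
    rw [Finset.sum_mul_sum]
    exact Finset.sum_congr rfl fun a _ => Finset.sum_congr rfl fun c _ => by ring
  simp_rw [h]
  rw [integral_finsetSum _ fun a _ => integrable_finsetSum _ fun c _ =>
    (hX.integrable_error_mul i a c).const_mul _]
  simp_rw [integral_finsetSum _ fun c (_ : c ∈ Finset.univ) =>
    (hX.integrable_error_mul i _ c).const_mul _, integral_const_mul, hX.integral_error_mul]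
  simp [popMoment, Matrix.mul_apply, Matrix.one_apply, Finset.mul_sum]
  refine Finset.sum_congr rfl fun a _ => by ring

/-- The expected squared error of a linear prediction. -/
lemma integral_sq_predError (i : ℕ) (s : Finset (Fin p)) (j : Fin p) (b : s → ℝ) :
    ∫ ω, (X i ω j - ∑ k : s, X i ω k * b k) ^ 2 ∂P = predError (popMoment γs β σ) s j b := by
  have hS : (popMoment γs β σ).IsSymm := by
    simpa using (popMoment_posDef γs β hX.sigma_pos).isHermitian
  set v : Fin p → ℝ := Pi.single j 1 - extend s b with hv
  have h : ∀ ω, (X i ω j - ∑ k : s, X i ω k * b k) ^ 2 =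
      ∑ k, ∑ l, v k * v l * (X i ω k * X i ω l) := by
    intro ω
    have h1 : X i ω j - ∑ k : s, X i ω k * b k = ∑ k, v k * X i ω k := by
      simp only [hv, Pi.sub_apply, sub_mul, Finset.sum_sub_distrib]
      rw [sum_extend]
      simp [Pi.single_apply, mul_comm]
    rw [h1, pow_two, Finset.sum_mul_sum]
    exact Finset.sum_congr rfl fun a _ => Finset.sum_congr rfl fun c _ => by ring
  simp_rw [h]
  rw [predError_eq_quadratic hS, ← hv, integral_finsetSum _ fun a _ =>
    integrable_finsetSum _ fun c _ => (hX.integrable_obs_mul i a c).const_mul _]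
  simp_rw [integral_finsetSum _ fun c (_ : c ∈ Finset.univ) =>
    (hX.integrable_obs_mul i _ c).const_mul _, integral_const_mul, hX.integral_obs_mul]
  simp only [dotProduct, Matrix.mulVec, Finset.mul_sum]
  exact Finset.sum_congr rfl fun a _ => Finset.sum_congr rfl fun c _ => by ring

lemma risk_eq_score (γ : DAG p) : risk P (X 0) γ = score 1 (popMoment γs β σ) γ := by
  have hpd := popMoment_posDef γs β hX.sigma_pos
  have hS : (popMoment γs β σ).IsSymm := by simpa using hpd.isHermitian
  rw [risk, score]
  refine Finset.sum_congr rfl fun j _ => ?_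
  simp_rw [hX.integral_sq_predError 0]
  have hdet := isUnit_det_block hpd (γ.parents j)
  rw [one_mul]
  refine IsLeast.csInf_eq ⟨⟨_, predError_inv hS hdet j⟩, ?_⟩
  rintro _ ⟨b, rfl⟩
  exact sub_explained_le_predError hpd.posSemidef hdet j b

lemma score_true_le : score 1 (popMoment γs β σ) γs ≤ p * σ ^ 2 := by
  have hpd := popMoment_posDef γs β hX.sigma_pos
  have h : ∀ j ∈ Finset.univ, popMoment γs β σ j j - 1 * explained (popMoment γs β σ)
      (γs.parents j) j ≤ σ ^ 2 := by
    intro j _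
    rw [one_mul]
    refine (sub_explained_le_predError hpd.posSemidef (isUnit_det_block hpd _) j (β j)).trans (le_of_eq ?_)
    rw [← hX.integral_sq_predError 0]
    have h1 : ∀ ω, (X 0 ω j - ∑ k : γs.parents j, X 0 ω k * β j k) ^ 2 = ε 0 ω j * ε 0 ω j := by
      intro ω
      have := hX.structural_eq 0 ω j
      rw [pow_two]
      congr 1 <;> linarith
    simp_rw [h1, hX.integral_error_mul]
    simp
  refine (Finset.sum_le_sum h).trans (le_of_eq ?_)
  simp

lemma score_true : score 1 (popMoment γs β σ) γs = p * σ ^ 2 :=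
  le_antisymm hX.score_true_le (le_score_popMoment γs β hX.coeff_ne_zero hX.sigma_pos)

lemma tendsto_meanProd : ∀ᵐ ω ∂P, Tendsto (fun n => meanProd (data X n ω)) atTop
    (𝓝 (popMoment γs β σ)) := by
  have hkl : ∀ k l, ∀ᵐ ω ∂P, Tendsto (fun n => meanProd (data X n ω) k l) atTop
      (𝓝 (popMoment γs β σ k l)) := by
    intro k l
    -- As a function of the error vector alone, the product inherits independence and identical
    -- distribution over `i`.
    set f : (Fin p → ℝ) → ℝ := fun e =>
      (totalEffects γs β *ᵥ e) k * (totalEffects γs β *ᵥ e) l with hf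
    have hfm : Measurable f := by
      simp only [hf, Matrix.mulVec, dotProduct]
      fun_prop
    have hfX : ∀ i ω, X i ω k * X i ω l = f (ε i ω) := by
      intro i ω
      rw [hX.obs_eq]
    have h := strong_law_ae_real (μ := P) (fun i ω => X i ω k * X i ω l)
      (hX.integrable_obs_mul 0 k l)
      (by
        intro i r hir
        simp only [Function.onFun, hfX]
        exact (hX.indepFun_error_vector hir).comp hfm hfm)
      (by
        intro i
        simp only [hfX]
        exact (hX.identDistrib_error i).comp hfm)
    filter_upwards [h] with ω hω
    rw [hX.integral_obs_mul] at hω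
    refine hω.congr fun n => ?_
    rw [meanProd, Matrix.smul_apply, sumProd_apply, smul_eq_mul, div_eq_inv_mul]
    congr 1
    exact (Fin.sum_univ_eq_sum_range (fun i => X i ω k * X i ω l) n).symm
  have hall : ∀ᵐ ω ∂P, ∀ k l, Tendsto (fun n => meanProd (data X n ω) k l) atTop
      (𝓝 (popMoment γs β σ k l)) := by
    rw [ae_all_iff]
    intro k
    rw [ae_all_iff]
    exact hkl k
  filter_upwards [hall] with ω hω
  exact tendsto_pi_nhds.2 fun k => tendsto_pi_nhds.2 fun l => hω k l

/-- The normalized inner product of the observations of a variable with the errors of a node that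
does not affect this variable is bounded in probability. -/
lemma isBigOp_noise {k j : Fin p} (hkj : totalEffects γs β k j = 0) :
    IsBigOp P fun n ω => (√(n : ℝ))⁻¹ * ∑ i : Fin n, X i ω k * ε i ω j := by
  set f : (Fin p → ℝ) → ℝ := fun e => (totalEffects γs β *ᵥ e) k * e j with hf
  have hfm : Measurable f := by
    simp only [hf, Matrix.mulVec, dotProduct]
    fun_prop
  have hfX : ∀ i ω, X i ω k * ε i ω j = f (ε i ω) := by
    intro i ω
    rw [hX.obs_eq]
  have hexp : ∀ i, (fun ω => X i ω k * ε i ω j) =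
      fun ω => ∑ a, totalEffects γs β k a * (ε i ω a * ε i ω j) := by
    intro i
    funext ω
    rw [hX.obs_eq]
    simp only [Matrix.mulVec, dotProduct, Finset.sum_mul, mul_assoc]
  -- Second moments suffice: for `a ≠ j` independence makes `ε_a ε_j` square integrable, and the
  -- term `ε_j²`, which would need a fourth moment, has coefficient zero by `hkj`.
  have hL2 : ∀ i, MemLp (fun ω => X i ω k * ε i ω j) 2 P := by
    intro i
    rw [hexp]
    refine memLp_finsetSum _ fun a _ => ?_
    rcases eq_or_ne a j with rfl | ha
    · simp [hkj]
    · refine MemLp.const_mul ?_ _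
      have hma : Measurable fun ω => ε i ω a * ε i ω j :=
        (hX.measurable_error_apply i a).mul (hX.measurable_error_apply i j)
      refine (memLp_two_iff_integrable_sq hma.aestronglyMeasurable).2 ?_
      have h1 := (hX.indepFun_error i ha).comp (φ := fun x : ℝ => x ^ 2)
        (ψ := fun x : ℝ => x ^ 2) (by fun_prop) (by fun_prop)
      have h2 := h1.integrable_mul (hX.memLp_error_apply i a).integrable_sq
        (hX.memLp_error_apply i j).integrable_sq
      refine h2.congr (Eventually.of_forall fun ω => ?_)
      simp [mul_pow]
  have hmean : ∀ i, ∫ ω, X i ω k * ε i ω j ∂P = 0 := by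
    intro i
    rw [hexp, integral_finsetSum _ fun a _ => (hX.integrable_error_mul i a j).const_mul _]
    simp_rw [integral_const_mul, hX.integral_error_mul]
    simp [Matrix.one_apply, hkj]
  have hid : ∀ i, IdentDistrib (fun ω => X i ω k * ε i ω j) (fun ω => X 0 ω k * ε 0 ω j) P P := by
    intro i
    simp only [hfX]
    exact (hX.identDistrib_error i).comp hfm
  have hm : ∀ i, Measurable fun ω => X i ω k * ε i ω j := fun i =>
    (hX.measurable_obs_apply i k).mul (hX.measurable_error_apply i j)
  refine isBigOp_of_variance_le (v := variance (fun ω => X 0 ω k * ε 0 ω j) P)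
    (fun n => (Finset.measurable_sum Finset.univ (f := fun (i : Fin n) ω => X i ω k * ε i ω j)
      fun i _ => hm i).const_mul _)
    (fun n => (memLp_finsetSum Finset.univ (f := fun (i : Fin n) ω => X i ω k * ε i ω j)
      fun i _ => hL2 i).const_mul _) (fun n => ?_) (fun n => ?_)
  · rw [integral_const_mul, integral_finsetSum Finset.univ
      (f := fun (i : Fin n) ω => X i ω k * ε i ω j) fun i _ => (hL2 i).integrable (by norm_num)]
    simp [hmean]
  · rw [variance_const_mul]
    have h1 : (fun ω => ∑ i : Fin n, X i ω k * ε i ω j) =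
        ∑ i : Fin n, fun ω => X i ω k * ε i ω j := by
      funext ω
      simp
    rw [h1, IndepFun.variance_sum (X := fun (i : Fin n) ω => X i ω k * ε i ω j)
      (fun i _ => hL2 i)]
    · simp_rw [fun i : ℕ => (hid i).variance_eq]
      rw [Finset.sum_const, Finset.card_univ, Fintype.card_fin, nsmul_eq_mul, inv_pow,
        Real.sq_sqrt (Nat.cast_nonneg n), ← mul_assoc]
      refine mul_le_of_le_one_left (variance_nonneg _ _) ?_
      rcases Nat.eq_zero_or_pos n with rfl | hn
      · simp
      · rw [inv_mul_cancel₀]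
        exact_mod_cast hn.ne'
    · intro i _ r _ hir
      simp only [hfX]
      exact (hX.indepFun_error_vector (fun h => hir (Fin.ext h))).comp hfm hfm

end IsSample

end Sample

-- Well-definedness in terms of mean moments, and limits of the two error terms

lemma posteriorDefined_iff_meanProd {n p : ℕ} (hn : 1 ≤ n) (hp : 1 ≤ p) (pr : PMF (DAG p))
    (hpos : ∀ γ, pr γ ≠ 0) (x : Fin n → Fin p → ℝ) :
    PosteriorDefined n pr x ↔
      (∀ (γ : DAG p) (j : Fin p), IsUnit (block (meanProd x) (γ.parents j)).det) ∧
      ∀ γ, 0 < score ((n : ℝ) / (1 + n)) (meanProd x) γ := by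
  have hn0 : (0 : ℝ) < n := by exact_mod_cast hn
  have ht : (n : ℝ)⁻¹ ≠ 0 := (inv_pos.2 hn0).ne'
  rw [posteriorDefined_iff hn hp pr hpos]
  have h1 : (∀ (γ : DAG p) (j : Fin p), IsUnit (block (meanProd x) (γ.parents j)).det) ↔
      ∀ (γ : DAG p) (j : Fin p), IsUnit (gram x γ j).det := by
    simp only [gram_eq_block, meanProd, isUnit_det_block_smul ht]
  rw [h1]
  refine and_congr_right fun hdet => forall_congr' fun γ => ?_
  rw [meanProd, score_smul ht _ _ γ fun j => by rw [← gram_eq_block]; exact hdet γ j]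
  exact (mul_pos_iff_of_pos_left (inv_pos.2 hn0)).symm

lemma meanProd_posSemidef {n p : ℕ} (x : Fin n → Fin p → ℝ) : (meanProd x).PosSemidef :=
  (sumProd_posSemidef x).smul (by positivity)

lemma tendsto_natCast_div_one_add : Tendsto (fun n : ℕ => (n : ℝ) / (1 + n)) atTop (𝓝 1) := by
  simpa only [add_comm] using tendsto_natCast_div_add_atTop (1 : ℝ)

lemma tendsto_exp_mul_rpow {a b : ℝ} (hb : 0 < b) :
    Tendsto (fun n : ℕ => Real.exp (-(n * b)) * (1 + (n : ℝ)) ^ a) atTop (𝓝 0) := by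
  have h := (tendsto_rpow_mul_exp_neg_mul_atTop_nhds_zero a b hb).comp
    (tendsto_atTop_add_const_left atTop (1 : ℝ) tendsto_natCast_atTop_atTop)
  -- The known limit is taken along `1 + n`; the factor `exp b` undoes the shift in the exponential.
  have h2 := h.const_mul (Real.exp b)
  rw [mul_zero] at h2
  refine h2.congr fun n => ?_
  simp only [Function.comp_apply]
  rw [mul_left_comm, ← Real.exp_add, mul_comm]
  congr 2
  ring

section StochasticOrder

variable {Ω : Type*} [MeasurableSpace Ω] {P : Measure Ω}

lemma IsBigOp.tendsto_measure_le_exp {A : ℕ → Ω → ℝ} (hA : IsBigOp P A) {e : ℝ} (he : 0 < e) :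
    Tendsto (fun n : ℕ => P {ω | e ≤ 1 / √(n : ℝ) * Real.exp (A n ω)}) atTop (𝓝 0) := by
  refine ENNReal.tendsto_nhds_zero.2 fun η hη => ?_
  obtain ⟨η', h0, hη'⟩ : ∃ η' : ℝ, 0 < η' ∧ ENNReal.ofReal η' ≤ η := by
    rcases eq_or_ne η ∞ with rfl | hne
    · exact ⟨1, one_pos, le_top⟩
    · exact ⟨η.toReal, ENNReal.toReal_pos hη.ne' hne, by rw [ENNReal.ofReal_toReal hne]⟩
  obtain ⟨M, hM⟩ := hA.2 η' h0
  have hlim : Tendsto (fun n : ℕ => 1 / √(n : ℝ) * Real.exp M) atTop (𝓝 0) := by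
    have h1 : Tendsto (fun n : ℕ => √(n : ℝ)) atTop atTop :=
      Real.tendsto_sqrt_atTop.comp tendsto_natCast_atTop_atTop
    simpa using (h1.inv_tendsto_atTop).mul_const (Real.exp M)
  filter_upwards [hM, hlim.eventually (gt_mem_nhds he)] with n hn hlt
  refine (measure_mono fun ω hω => ?_).trans (hn.trans hη')
  simp only [Set.mem_ofPred_eq] at hω ⊢
  by_contra hc
  have h2 : A n ω ≤ M := (le_abs_self _).trans (not_lt.1 hc)
  have h3 : 1 / √(n : ℝ) * Real.exp (A n ω) ≤ 1 / √(n : ℝ) * Real.exp M := by gcongr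
  linarith

lemma IsLittleOp.tendsto_measure_le_expTerm {B : ℕ → Ω → ℝ} (hB : IsLittleOp P B) {p : ℕ}
    (hp : 1 ≤ p) (γs : DAG p) {δ : ℝ} (hδ : γs.edges.Nonempty → 0 < δ) {e : ℝ} (he : 0 < e) :
    Tendsto (fun n : ℕ => P {ω | e ≤ expTerm γs n δ (B n ω)}) atTop (𝓝 0) := by
  rcases γs.edges.eq_empty_or_nonempty with h0 | h0
  · simp [expTerm, h0, not_le.2 he]
  · have hδ := hδ h0
    have hp0 : (0 : ℝ) < p := by exact_mod_cast hp
    have h1 := tendstoInMeasure_iff_dist.1 hB.2 (δ / 2) (by positivity)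
    -- While `|B n| < δ/2`, the exponent is at most `-n p δ / 4`, and this beats the power of `1 +
    -- n`.
    have h2 := tendsto_exp_mul_rpow (a := (γs.edges.card : ℝ) / 2)
      (b := p * δ / 4) (by positivity)
    refine tendsto_of_tendsto_of_tendsto_of_le_of_le' tendsto_const_nhds h1
      (Eventually.of_forall fun _ => zero_le) ?_
    filter_upwards [h2.eventually (gt_mem_nhds he)] with n hn
    refine measure_mono fun ω hω => ?_
    simp only [Set.mem_ofPred_eq, Real.dist_eq, sub_zero] at hω ⊢
    by_contra hc
    have h3 := (abs_lt.1 (not_le.1 hc)).1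
    rw [expTerm, if_neg h0.ne_empty] at hω
    have h4 : Real.exp (-((n : ℝ) * p / 2) * (δ + B n ω)) ≤ Real.exp (-(n * (p * δ / 4))) := by
      rw [Real.exp_le_exp]
      have h5 : 0 ≤ (n : ℝ) * p / 2 := by positivity
      nlinarith
    have h6 := mul_le_mul_of_nonneg_right h4
      (show 0 ≤ (1 + (n : ℝ)) ^ ((γs.edges.card : ℝ) / 2) by positivity)
    linarith

end StochasticOrder

-- Supergraphs, gaps and the limits of the scores

namespace IsSample

variable {Ω : Type*} [MeasurableSpace Ω] {P : Measure Ω}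
  {p : ℕ} {γs : DAG p} {β : (j : Fin p) → γs.parents j → ℝ} {ν : Fin p → Measure ℝ} {σ : ℝ}
  {ε X : ℕ → Ω → Fin p → ℝ}

/-- The score of a graph for the first `n` observations, divided by `n`. -/
def meanScore (X : ℕ → Ω → Fin p → ℝ) (γ : DAG p) (n : ℕ) (ω : Ω) : ℝ :=
  score ((n : ℝ) / (1 + n)) (meanProd (data X n ω)) γ

/-- The squared size of the projection of the noise on the parents. -/
def noiseSize (ε X : ℕ → Ω → Fin p → ℝ) (γ : DAG p) (n : ℕ) (ω : Ω) : ℝ :=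
  ∑ j, (fun k : γ.parents j => (√(n : ℝ))⁻¹ * ∑ i : Fin n, X i ω k * ε i ω j) ⬝ᵥ
    (block (meanProd (data X n ω)) (γ.parents j))⁻¹ *ᵥ
      (fun k : γ.parents j => (√(n : ℝ))⁻¹ * ∑ i : Fin n, X i ω k * ε i ω j)

/-- A bound for the logarithm of the likelihood ratio of a supergraph. -/
def excess (ε X : ℕ → Ω → Fin p → ℝ) (γ : DAG p) (n : ℕ) (ω : Ω) : ℝ :=
  (p : ℝ) / 2 * |noiseSize ε X γ n ω| * |(meanScore X γ n ω)⁻¹|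

/-- The deviation of the empirical gap from the population gap. -/
def gapDeviation (P : Measure Ω) (X : ℕ → Ω → Fin p → ℝ) (γs γ : DAG p) (n : ℕ) (ω : Ω) : ℝ :=
  Real.log (meanScore X γ n ω / meanScore X γs n ω) -
    Real.log (risk P (X 0) γ / risk P (X 0) γs)

lemma finite_gaps : (gaps P (X 0) σ γs).Finite := by
  refine (Set.finite_range fun γ : DAG p =>
    Real.log (risk P (X 0) γ) - Real.log (p * σ ^ 2)).subset ?_
  rintro d ⟨γ, -, rfl⟩
  exact ⟨γ, rfl⟩

variable (hX : IsSample P γs β ν σ ε X)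
include hX

lemma measurable_meanScore (γ : DAG p) (n : ℕ) : Measurable (meanScore X γ n) :=
  measurable_score _ (hX.measurable_meanProd n) γ

lemma isUnit_det_block_popMoment (s : Finset (Fin p)) :
    IsUnit (block (popMoment γs β σ) s).det :=
  isUnit_det_block (popMoment_posDef γs β hX.sigma_pos) s

/-- By `log t ≤ t - 1` the logarithm is at most a relative difference of scores, which is of order
`1/n` times the noise projection; the factor `n` in front cancels. -/
lemma log_ratio_le_excess (hp : 1 ≤ p) {γ : DAG p} (hsub : γs.edges ⊆ γ.edges)
    {n : ℕ} (hn : 1 ≤ n) (ω : Ω)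
    (hdet : ∀ (γ : DAG p) (j : Fin p),
      IsUnit (block (meanProd (data X n ω)) (γ.parents j)).det)
    (hS : ∀ γ, 0 < meanScore X γ n ω) :
    (n * p : ℝ) / 2 * Real.log (meanScore X γs n ω / meanScore X γ n ω) ≤
      excess ε X γ n ω := by
  have hn0 : (0 : ℝ) < n := by exact_mod_cast hn
  have hdiff : meanScore X γs n ω - meanScore X γ n ω ≤ (n : ℝ)⁻¹ * noiseSize ε X γ n ω := by
    have h := score_sub_score_le (meanProd_posSemidef (data X n ω)) hsub (hdet γ) (hdet γs) β
      (c := (n : ℝ) / (1 + n)) (by positivity) (div_one_add_le_one n)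
      -- The factor `1/n` of the mean is split in two: one root normalizes the noise sum, the other
      -- leaves the quadratic form as `1/n`.
      (fun j => (√(n : ℝ))⁻¹ • fun k : γ.parents j =>
        (√(n : ℝ))⁻¹ * ∑ i : Fin n, X i ω k * ε i ω j) (by
        intro j k
        have h1 : ∀ i : Fin n, X i ω k * ε i ω j =
            X i ω k * X i ω j - ∑ l : γs.parents j, β j l * (X i ω k * X i ω l) := by
          intro i
          have h2 := hX.structural_eq i ω j
          have h3 : ε i ω j = X i ω j - ∑ l : γs.parents j, X i ω l * β j l := by linarith
          rw [h3, mul_sub, Finset.mul_sum]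
          congr 1
          exact Finset.sum_congr rfl fun l _ => by ring
        rw [Pi.smul_apply, smul_eq_mul, ← mul_assoc, ← mul_inv, Real.mul_self_sqrt hn0.le]
        simp_rw [h1]
        rw [Finset.sum_sub_distrib, Finset.sum_comm, mul_sub]
        simp only [meanProd, Matrix.smul_apply, sumProd_apply, data, smul_eq_mul, Finset.mul_sum]
        congr 1
        exact Finset.sum_congr rfl fun l _ => Finset.sum_congr rfl fun i _ => by ring)
    refine h.trans (le_of_eq ?_)
    rw [noiseSize, Finset.mul_sum]
    refine Finset.sum_congr rfl fun j _ => ?_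
    rw [Matrix.mulVec_smul, dotProduct_smul, smul_dotProduct, smul_eq_mul, smul_eq_mul,
      ← mul_assoc, ← mul_inv, Real.mul_self_sqrt hn0.le]
  have hs := hS γs
  have hr := hS γ
  have hlog := Real.log_le_sub_one_of_pos (div_pos hs hr)
  have h1 : meanScore X γs n ω / meanScore X γ n ω - 1 =
      (meanScore X γs n ω - meanScore X γ n ω) * (meanScore X γ n ω)⁻¹ := by
    field_simp
  calc (n * p : ℝ) / 2 * Real.log (meanScore X γs n ω / meanScore X γ n ω)
      ≤ (n * p : ℝ) / 2 * (((n : ℝ)⁻¹ * |noiseSize ε X γ n ω|) * (meanScore X γ n ω)⁻¹) := by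
        refine mul_le_mul_of_nonneg_left ?_ (by positivity)
        rw [h1] at hlog
        refine hlog.trans (mul_le_mul_of_nonneg_right (hdiff.trans ?_) (by positivity))
        exact mul_le_mul_of_nonneg_left (le_abs_self _) (by positivity)
    _ = excess ε X γ n ω := by
        rw [excess, abs_of_pos (inv_pos.2 hr)]
        field_simp

variable [IsProbabilityMeasure P]

lemma risk_pos (hp : 1 ≤ p) (γ : DAG p) : 0 < risk P (X 0) γ := by
  rw [hX.risk_eq_score]
  have h1 := le_score_popMoment γ β hX.coeff_ne_zero hX.sigma_pos
  have h2 : (0 : ℝ) < p := by exact_mod_cast hp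
  have h3 := hX.sigma_pos
  exact lt_of_lt_of_le (by positivity) h1

lemma risk_true : risk P (X 0) γs = p * σ ^ 2 := by
  rw [hX.risk_eq_score, hX.score_true]

lemma gap_pos (hp : 1 ≤ p) {γ : DAG p} (hγ : ¬ γs.edges ⊆ γ.edges) :
    0 < Real.log (risk P (X 0) γ) - Real.log (p * σ ^ 2) := by
  have h1 : p * σ ^ 2 < risk P (X 0) γ := by
    rw [hX.risk_eq_score]
    by_contra h
    exact hγ (subset_of_score_popMoment_le γ β hX.coeff_ne_zero hX.sigma_pos (not_lt.1 h)).1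
  have h2 : (0 : ℝ) < p := by exact_mod_cast hp
  have h3 := hX.sigma_pos
  linarith [Real.log_lt_log (by positivity) h1]

lemma isLeast_minGap (hp : 1 ≤ p) (hne : γs.edges.Nonempty) :
    IsLeast (gaps P (X 0) σ γs) (minGap P (X 0) σ γs) ∧ 0 < minGap P (X 0) σ γs := by
  have hg : (gaps P (X 0) σ γs).Nonempty := by
    -- The graph without edges is not a supergraph of `γs`, so the finite set of gaps is nonempty.
    refine ⟨_, ⟨∅, fun j h => ?_⟩, fun h => ?_, rfl⟩
    · obtain ⟨k, hk, -⟩ := Relation.TransGen.head'_iff.1 h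
      simp at hk
    · obtain ⟨e, he⟩ := hne
      simpa using h he
  have hmem : minGap P (X 0) σ γs ∈ gaps P (X 0) σ γs := hg.csInf_mem finite_gaps
  refine ⟨⟨hmem, fun d hd => csInf_le finite_gaps.bddBelow hd⟩, ?_⟩
  obtain ⟨γ, hγ, h⟩ := hmem
  rw [h]
  exact hX.gap_pos hp hγ

lemma tendsto_meanScore (γ : DAG p) :
    ∀ᵐ ω ∂P, Tendsto (fun n => meanScore X γ n ω) atTop (𝓝 (risk P (X 0) γ)) := by
  filter_upwards [hX.tendsto_meanProd] with ω hω
  rw [hX.risk_eq_score]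
  exact tendsto_score tendsto_natCast_div_one_add hω γ
    fun j => hX.isUnit_det_block_popMoment _

/-- The posterior is well defined on measurable events whose probability tends to one. -/
lemma exists_measurable_subset_posteriorDefined (hp : 1 ≤ p) (pr : PMF (DAG p))
    (hpos : ∀ γ, pr γ ≠ 0) : ∃ D : ℕ → Set Ω, (∀ n, MeasurableSet (D n)) ∧
      (∀ n, 1 ≤ n → D n ⊆ {ω | PosteriorDefined n pr (data X n ω)}) ∧
      Tendsto (fun n => P (D n)) atTop (𝓝 1) := by
  -- Determinants and scores are visibly measurable in the data, so measurability of the event that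
  -- the posterior is defined never has to be shown.
  set D : ℕ → Set Ω := fun n =>
    (⋂ (γ : DAG p) (j : Fin p), {ω | (block (meanProd (data X n ω)) (γ.parents j)).det ≠ 0}) ∩
      ⋂ γ : DAG p, {ω | 0 < meanScore X γ n ω} with hD
  have hmeas : ∀ n, MeasurableSet (D n) := by
    intro n
    refine MeasurableSet.inter (MeasurableSet.iInter fun γ => MeasurableSet.iInter fun j => ?_)
      (MeasurableSet.iInter fun γ => measurableSet_lt measurable_const
        (hX.measurable_meanScore γ n))
    have hm : Measurable fun ω => (block (meanProd (data X n ω)) (γ.parents j)).det :=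
      measurable_det fun k l => hX.measurable_meanProd n k l
    exact (hm (measurableSet_singleton 0)).compl
  refine ⟨D, hmeas, fun n hn ω hω => ?_, tendsto_measure_of_ae_eventually hmeas ?_⟩
  · simp only [hD, Set.mem_inter_iff, Set.mem_iInter, Set.mem_ofPred_eq] at hω
    refine (posteriorDefined_iff_meanProd hn hp pr hpos _).2 ⟨fun γ j => ?_, hω.2⟩
    exact isUnit_iff_ne_zero.2 (hω.1 γ j)
  · have hall : ∀ᵐ ω ∂P, ∀ γ, Tendsto (fun n => meanScore X γ n ω) atTop
        (𝓝 (risk P (X 0) γ)) := ae_all_iff.2 hX.tendsto_meanScore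
    filter_upwards [hX.tendsto_meanProd, hall] with ω h1 h2
    simp only [hD, Set.mem_inter_iff, Set.mem_iInter, Set.mem_ofPred_eq]
    refine Eventually.and ?_ ?_
    · refine eventually_all.2 fun γ => eventually_all.2 fun j => ?_
      have h3 := ((continuous_id.matrix_det).tendsto _).comp (tendsto_block h1 (γ.parents j))
      exact h3.eventually_ne (hX.isUnit_det_block_popMoment (γ.parents j)).ne_zero
    · exact eventually_all.2 fun γ => (h2 γ).eventually (lt_mem_nhds (hX.risk_pos hp γ))

lemma isBigOp_inv_block (s : Finset (Fin p)) (k l : s) :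
    IsBigOp P fun n ω => (block (meanProd (data X n ω)) s)⁻¹ k l := by
  refine isBigOp_of_tendsto_ae (c := (block (popMoment γs β σ) s)⁻¹ k l)
    (fun n => measurable_inv_apply (Y := fun ω => block (meanProd (data X n ω)) s)
      (fun a b => hX.measurable_meanProd n a b) k l) ?_
  filter_upwards [hX.tendsto_meanProd] with ω hω
  have h := tendsto_matrix_inv (hX.isUnit_det_block_popMoment s) (tendsto_block hω s)
  exact tendsto_pi_nhds.1 (tendsto_pi_nhds.1 h k) l

/-- The normalized noise vectors are bounded in probability because parents in `γ` are unaffected by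
the error of the child, and the inverse moment blocks converge. -/
lemma isBigOp_noiseSize {γ : DAG p} (hsub : γs.edges ⊆ γ.edges) :
    IsBigOp P (noiseSize ε X γ) := by
  have hu : ∀ j (k : γ.parents j), IsBigOp P fun n ω =>
      (√(n : ℝ))⁻¹ * ∑ i : Fin n, X i ω k * ε i ω j := fun j k =>
    hX.isBigOp_noise (totalEffects_eq_zero hsub β j _ k rfl
      (γ.rank_lt (γ.mem_parents.1 k.2)))
  unfold noiseSize
  simp only [dotProduct, Matrix.mulVec]
  exact isBigOp_sum _ fun j _ => isBigOp_sum _ fun k _ => (hu j k).mul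
    (isBigOp_sum _ fun l _ => (hX.isBigOp_inv_block _ k l).mul (hu j l))

lemma isBigOp_excess (hp : 1 ≤ p) {γ : DAG p} (hsub : γs.edges ⊆ γ.edges) :
    IsBigOp P (excess ε X γ) := by
  have h : IsBigOp P fun n ω => (meanScore X γ n ω)⁻¹ := by
    refine isBigOp_of_tendsto_ae (c := (risk P (X 0) γ)⁻¹)
      (fun n => (hX.measurable_meanScore γ n).inv) ?_
    filter_upwards [hX.tendsto_meanScore γ] with ω hω
    exact hω.inv₀ (hX.risk_pos hp γ).ne'
  exact ((isBigOp_const _).mul (hX.isBigOp_noiseSize hsub).abs).mul h.abs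

lemma measurable_and_tendsto_gapDeviation (hp : 1 ≤ p) (γ : DAG p) :
    (∀ n, Measurable (gapDeviation P X γs γ n)) ∧
      ∀ᵐ ω ∂P, Tendsto (fun n => gapDeviation P X γs γ n ω) atTop (𝓝 0) := by
  refine ⟨fun n => (((hX.measurable_meanScore γ n).div
    (hX.measurable_meanScore γs n)).log).sub_const _, ?_⟩
  filter_upwards [hX.tendsto_meanScore γ, hX.tendsto_meanScore γs] with ω h1 h2
  have hs := hX.risk_pos hp γs
  have hr := hX.risk_pos hp γ
  have h3 := ((h1.div h2 hs.ne').log (div_pos hr hs).ne').sub_const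
    (Real.log (risk P (X 0) γ / risk P (X 0) γs))
  rwa [sub_self] at h3

end IsSample

-- Assembly of the bound and consistency

namespace IsSample

variable {Ω : Type*} {p : ℕ} {γs : DAG p} {β : (j : Fin p) → γs.parents j → ℝ}
  {ν : Fin p → Measure ℝ} {σ : ℝ}
  {ε X : ℕ → Ω → Fin p → ℝ}

lemma excess_nonneg (γ : DAG p) (n : ℕ) (ω : Ω) : 0 ≤ excess ε X γ n ω := by
  unfold excess
  positivity

variable [MeasurableSpace Ω] {P : Measure Ω}

open Classical in
/-- The proper supergraphs of a graph. -/
def properSupergraphs (γs : DAG p) : Finset (DAG p) :=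
  Finset.univ.filter fun γ => γ ≠ γs ∧ γs.edges ⊆ γ.edges

open Classical in
/-- The graphs that are not supergraphs of a graph. -/
def nonSupergraphs (γs : DAG p) : Finset (DAG p) :=
  Finset.univ.filter fun γ => ¬ γs.edges ⊆ γ.edges

/-- An upper bound for the sum of the prior odds. -/
def oddsBound (p : ℕ) (C : ℝ) : ℝ := Fintype.card (DAG p) * C + 1

/-- The total deviation of the empirical gaps from the population gaps. -/
def totalDeviation (P : Measure Ω) (X : ℕ → Ω → Fin p → ℝ) (γs : DAG p) (C : ℝ) (n : ℕ) (ω : Ω) :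
    ℝ :=
  -(∑ γ ∈ nonSupergraphs γs, |gapDeviation P X γs γ n ω| +
    2 / (n * p : ℝ) * Real.log (oddsBound p C))

/-- The sum of the bounds for the log likelihood ratios of the proper supergraphs. -/
def totalExcess (ε X : ℕ → Ω → Fin p → ℝ) (γs : DAG p) (C : ℝ) (n : ℕ) (ω : Ω) : ℝ :=
  Real.log (oddsBound p C) + ∑ γ ∈ properSupergraphs γs, excess ε X γ n ω

lemma oddsBound_pos {C : ℝ} (hC : 0 < C) : 0 < oddsBound p C := by
  unfold oddsBound
  positivity

lemma card_mul_le_oddsBound {C : ℝ} (hC : 0 < C) (s : Finset (DAG p)) :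
    s.card * C ≤ oddsBound p C := by
  have : (s.card : ℝ) ≤ Fintype.card (DAG p) := by exact_mod_cast s.card_le_univ
  unfold oddsBound
  nlinarith

variable (hX : IsSample P γs β ν σ ε X)
include hX

variable [IsProbabilityMeasure P]

lemma isBigOp_totalExcess (hp : 1 ≤ p) (C : ℝ) : IsBigOp P (totalExcess ε X γs C) := by
  refine (isBigOp_const _).add (isBigOp_sum _ fun γ hγ => hX.isBigOp_excess hp ?_)
  simp only [properSupergraphs, Finset.mem_filter] at hγ
  exact hγ.2.2

lemma isLittleOp_totalDeviation (hp : 1 ≤ p) (C : ℝ) :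
    IsLittleOp P (totalDeviation P X γs C) := by
  refine isLittleOp_of_tendsto_ae (fun n => ?_) ?_
  · exact ((Finset.measurable_sum _ fun γ _ =>
      ((hX.measurable_and_tendsto_gapDeviation hp γ).1 n).abs).add_const _).neg
  · have hall : ∀ᵐ ω ∂P, ∀ γ : DAG p, Tendsto (fun n => gapDeviation P X γs γ n ω) atTop (𝓝 0) :=
      ae_all_iff.2 fun γ => (hX.measurable_and_tendsto_gapDeviation hp γ).2
    have hp0 : (0 : ℝ) < p := by exact_mod_cast hp
    have h1 : Tendsto (fun n : ℕ => 2 / (n * p : ℝ) * Real.log (oddsBound p C)) atTop (𝓝 0) := by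
      have h2 : Tendsto (fun n : ℕ => (n * p : ℝ)) atTop atTop :=
        tendsto_natCast_atTop_atTop.atTop_mul_const hp0
      simpa using (h2.const_div_atTop 2).mul_const (Real.log (oddsBound p C))
    filter_upwards [hall] with ω hω
    have h3 := ((tendsto_finsetSum (nonSupergraphs γs) fun γ _ => (hω γ).abs).add h1).neg
    simpa [totalDeviation] using h3

/-- The population gap of `γ` is at least `δ*`, and the empirical gap differs from it by
`gapDeviation`. Summing the deviations over all non-supergraphs makes the bound uniform in `γ`. -/
lemma exp_log_ratio_le (hp : 1 ≤ p) {γ : DAG p} (hγ : γ ∈ nonSupergraphs γs) (n : ℕ) (ω : Ω) :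
    Real.exp ((n * p : ℝ) / 2 * Real.log (meanScore X γs n ω / meanScore X γ n ω)) ≤
      Real.exp (-((n : ℝ) * p / 2) * (minGap P (X 0) σ γs -
        ∑ γ ∈ nonSupergraphs γs, |gapDeviation P X γs γ n ω|)) := by
  have hsub : ¬ γs.edges ⊆ γ.edges := by
    simpa [nonSupergraphs] using hγ
  have h1 : minGap P (X 0) σ γs ≤ Real.log (risk P (X 0) γ / risk P (X 0) γs) := by
    rw [Real.log_div (hX.risk_pos hp γ).ne' (hX.risk_pos hp γs).ne', hX.risk_true]
    exact csInf_le finite_gaps.bddBelow ⟨γ, hsub, rfl⟩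
  have h2 : |gapDeviation P X γs γ n ω| ≤
      ∑ γ ∈ nonSupergraphs γs, |gapDeviation P X γs γ n ω| :=
    Finset.single_le_sum (f := fun γ => |gapDeviation P X γs γ n ω|)
      (fun _ _ => abs_nonneg _) hγ
  have h3 := neg_abs_le (gapDeviation P X γs γ n ω)
  have h4 : Real.log (meanScore X γs n ω / meanScore X γ n ω) =
      -(gapDeviation P X γs γ n ω + Real.log (risk P (X 0) γ / risk P (X 0) γs)) := by
    rw [gapDeviation, sub_add_cancel, ← Real.log_inv, inv_div]
  rw [Real.exp_le_exp, h4]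
  have h5 : 0 ≤ (n : ℝ) * p / 2 := by positivity
  nlinarith

/-- The sum over the proper supergraphs is kept as it stands because it is empty when `γs` is
complete. -/
lemma one_sub_posterior_le_sum (hp : 1 ≤ p) {pr : PMF (DAG p)} (hpos : ∀ γ, pr γ ≠ 0) {C : ℝ}
    (hC : 0 < C) (hprior : ∀ γ γ', (pr γ).toReal / (pr γ').toReal ≤ C) {n : ℕ} (hn : 1 ≤ n)
    {ω : Ω} (hdef : PosteriorDefined n pr (data X n ω)) :
    1 - posterior n pr (data X n ω) γs ≤
      (∑ γ ∈ properSupergraphs γs, C * (1 / √(n : ℝ)) * Real.exp (excess ε X γ n ω)) +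
        expTerm γs n (minGap P (X 0) σ γs) (totalDeviation P X γs C n ω) := by
  classical
  obtain ⟨hdet, hS⟩ := (posteriorDefined_iff_meanProd hn hp pr hpos _).1 hdef
  have hS' : ∀ γ, 0 < meanScore X γ n ω := hS
  have hn0 : (0 : ℝ) < n := by exact_mod_cast hn
  have hp0 : (0 : ℝ) < p := by exact_mod_cast hp
  have hsplit : Finset.univ.filter (· ≠ γs) = properSupergraphs γs ∪ nonSupergraphs γs := by
    ext γ
    simp only [properSupergraphs, nonSupergraphs, Finset.mem_union, Finset.mem_filter,
      Finset.mem_univ, true_and]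
    constructor
    · intro h
      by_cases hs : γs.edges ⊆ γ.edges
      · exact Or.inl ⟨h, hs⟩
      · exact Or.inr hs
    · rintro (h | h)
      · exact h.1
      · rintro rfl
        exact h (Finset.Subset.refl _)
  have hdisj : Disjoint (properSupergraphs γs) (nonSupergraphs γs) := by
    rw [Finset.disjoint_left]
    intro γ h1 h2
    simp only [properSupergraphs, nonSupergraphs, Finset.mem_filter] at h1 h2
    exact h2.2 h1.2.2
  have hmain := one_sub_posterior_le hn hp pr hpos hprior (data X n ω) hdef γs
  refine hmain.trans ?_
  rw [Finset.sum_congr (s₂ := properSupergraphs γs ∪ nonSupergraphs γs) (by ext γ; simp [← hsplit])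
    fun _ _ => rfl, Finset.sum_union hdisj]
  refine add_le_add (Finset.sum_le_sum fun γ hγ => ?_) ?_
  · simp only [properSupergraphs, Finset.mem_filter] at hγ
    have hcard : γs.edges.card < γ.edges.card := by
      refine Finset.card_lt_card (Finset.ssubset_iff_subset_ne.2 ⟨hγ.2.2, fun h => ?_⟩)
      exact hγ.2.1 (DAG.ext h.symm)
    have h1 := sqrt_pow_mul_inv_pow_le_of_lt hn hcard
    have h2 := hX.log_ratio_le_excess hp hγ.2.2 hn ω hdet hS'
    refine mul_le_mul (mul_le_mul_of_nonneg_left h1 hC.le) (Real.exp_le_exp.2 h2)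
      (Real.exp_pos _).le (by positivity)
  -- Without true edges every graph is a supergraph, in accordance with the value `0` of `expTerm`.
  · rcases γs.edges.eq_empty_or_nonempty with h0 | h0
    · have : nonSupergraphs γs = ∅ := by
        simp [nonSupergraphs, h0]
      simp [this, expTerm, h0]
    · rw [expTerm, if_neg h0.ne_empty]
      set D := ∑ γ ∈ nonSupergraphs γs, |gapDeviation P X γs γ n ω| with hD
      set E := (1 + (n : ℝ)) ^ ((γs.edges.card : ℝ) / 2) with hE
      have hE0 : 0 ≤ E := by positivity
      calc _ ≤ ∑ γ ∈ nonSupergraphs γs, C * E *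
            Real.exp (-((n : ℝ) * p / 2) * (minGap P (X 0) σ γs - D)) := by
            refine Finset.sum_le_sum fun γ hγ => ?_
            have h1 := sqrt_pow_mul_inv_pow_le n γs.edges.card γ.edges.card
            have h2 := hX.exp_log_ratio_le hp hγ n ω
            exact mul_le_mul (mul_le_mul_of_nonneg_left h1 hC.le) h2 (Real.exp_pos _).le
              (by positivity)
        _ = ((nonSupergraphs γs).card * C) *
            (Real.exp (-((n : ℝ) * p / 2) * (minGap P (X 0) σ γs - D)) * E) := by
            rw [Finset.sum_const, nsmul_eq_mul]
            ring
        _ ≤ oddsBound p C *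
            (Real.exp (-((n : ℝ) * p / 2) * (minGap P (X 0) σ γs - D)) * E) :=
            mul_le_mul_of_nonneg_right (card_mul_le_oddsBound hC _) (by positivity)
        _ = _ := by
            -- The constant moves into the exponent, where division by `np/2` turns its logarithm
            -- into the vanishing second part of `totalDeviation`.
            rw [← mul_assoc, ← Real.exp_log (oddsBound_pos (p := p) hC), ← Real.exp_add, totalDeviation, ← hD]
            congr 2
            field_simp
            ring

/-- The excesses are nonnegative, so each is at most their sum; number of graphs and prior odds
enter the exponent as a constant. -/
lemma one_sub_posterior_le_exp (hp : 1 ≤ p) {pr : PMF (DAG p)} (hpos : ∀ γ, pr γ ≠ 0) {C : ℝ}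
    (hC : 0 < C) (hprior : ∀ γ γ', (pr γ).toReal / (pr γ').toReal ≤ C) {n : ℕ} (hn : 1 ≤ n)
    {ω : Ω} (hdef : PosteriorDefined n pr (data X n ω)) :
    1 - posterior n pr (data X n ω) γs ≤
      1 / √(n : ℝ) * Real.exp (totalExcess ε X γs C n ω) +
        expTerm γs n (minGap P (X 0) σ γs) (totalDeviation P X γs C n ω) := by
  refine (hX.one_sub_posterior_le_sum hp hpos hC hprior hn hdef).trans
    (add_le_add_left ?_ _)
  set E := ∑ γ ∈ properSupergraphs γs, excess ε X γ n ω with hE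
  calc ∑ γ ∈ properSupergraphs γs, C * (1 / √(n : ℝ)) * Real.exp (excess ε X γ n ω)
      ≤ ∑ γ ∈ properSupergraphs γs, C * (1 / √(n : ℝ)) * Real.exp E := by
        refine Finset.sum_le_sum fun γ hγ => ?_
        refine mul_le_mul_of_nonneg_left (Real.exp_le_exp.2 ?_) (by positivity)
        exact Finset.single_le_sum (f := fun γ => excess ε X γ n ω)
          (fun γ _ => excess_nonneg γ n ω) hγ
    _ = ((properSupergraphs γs).card * C) * (1 / √(n : ℝ) * Real.exp E) := by
        rw [Finset.sum_const, nsmul_eq_mul]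
        ring
    _ ≤ oddsBound p C * (1 / √(n : ℝ) * Real.exp E) :=
        mul_le_mul_of_nonneg_right (card_mul_le_oddsBound hC _) (by positivity)
    _ = 1 / √(n : ℝ) * Real.exp (totalExcess ε X γs C n ω) := by
        rw [totalExcess, Real.exp_add, Real.exp_log (oddsBound_pos hC)]
        ring

lemma tendstoInMeasure_posterior (hp : 1 ≤ p) {pr : PMF (DAG p)} (hpos : ∀ γ, pr γ ≠ 0) {C : ℝ}
    (hC : 0 < C) (hprior : ∀ γ γ', (pr γ).toReal / (pr γ').toReal ≤ C) :
    TendstoInMeasure P (fun (n : ℕ) ω => posterior n pr (data X n ω) γs) atTop (fun _ => 1) := by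
  obtain ⟨D, hDm, hDs, hDt⟩ := hX.exists_measurable_subset_posteriorDefined hp pr hpos
  rw [tendstoInMeasure_iff_dist]
  intro e he
  have h1 := (hX.isBigOp_totalExcess hp C).tendsto_measure_le_exp (half_pos he)
  have h2 := (hX.isLittleOp_totalDeviation hp C).tendsto_measure_le_expTerm hp γs
    (fun hne => (hX.isLeast_minGap hp hne).2) (half_pos he)
  have h3 : Tendsto (fun n => P (D n)ᶜ) atTop (𝓝 0) := by
    simp_rw [fun n => prob_compl_eq_one_sub (μ := P) (hDm n)]
    simpa using ENNReal.Tendsto.sub tendsto_const_nhds hDt (Or.inl ENNReal.one_ne_top)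
  have h4 := (h1.add h2).add h3
  simp only [add_zero] at h4
  refine tendsto_of_tendsto_of_tendsto_of_le_of_le' tendsto_const_nhds h4
    (Eventually.of_forall fun _ => zero_le) ?_
  -- A deviation of `e` requires that one of the two error terms reaches `e / 2` or that `D n`
  -- fails.
  filter_upwards [eventually_ge_atTop 1] with n hn
  refine (measure_mono ?_).trans ((measure_union_le _ _).trans
    (add_le_add_left (measure_union_le _ _) _))
  intro ω hω
  by_contra hc
  simp only [Set.mem_union, Set.mem_ofPred_eq, Set.mem_compl_iff, not_or, not_not, not_le]
    at hc hω
  obtain ⟨⟨hc1, hc2⟩, hc3⟩ := hc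
  have h5 := hX.one_sub_posterior_le_exp hp hpos hC hprior hn (hDs n hn hc3)
  have h6 := posterior_le_one n pr (data X n ω) γs
  rw [dist_comm, Real.dist_eq, abs_of_nonneg (by linarith)] at hω
  linarith

end IsSample

end EqualVarSEM

end

theorem theorem2 {Ω : Type*} [MeasurableSpace Ω] (P : Measure Ω) [IsProbabilityMeasure P]
    (p : ℕ) (hp : 1 ≤ p) (γs : EqualVarSEM.DAG p)
    (β : (j : Fin p) → γs.parents j → ℝ) (ν : Fin p → Measure ℝ) (σ : ℝ)
    (ε X : ℕ → Ω → Fin p → ℝ) (hX : EqualVarSEM.IsSample P γs β ν σ ε X)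
    (pr : PMF (EqualVarSEM.DAG p)) (hpos : ∀ γ, pr γ ≠ 0)
    (C : ℝ) (hC : 0 < C) (hprior : ∀ γ γ', (pr γ).toReal / (pr γ').toReal ≤ C) :
    -- the minimum that defines `δ*` is attained and positive
    (γs.edges.Nonempty →
      IsLeast (EqualVarSEM.gaps P (X 0) σ γs) (EqualVarSEM.minGap P (X 0) σ γs) ∧
        0 < EqualVarSEM.minGap P (X 0) σ γs) ∧
    -- the posterior is well defined with probability tending to one
    Tendsto (fun n : ℕ => P {ω | EqualVarSEM.PosteriorDefined n pr (EqualVarSEM.data X n ω)})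
      atTop (𝓝 1) ∧
    -- the bound with `g = n`
    (∃ A B : ℕ → Ω → ℝ, EqualVarSEM.IsBigOp P A ∧ EqualVarSEM.IsLittleOp P B ∧
      ∀ n : ℕ, 1 ≤ n → ∀ ω, EqualVarSEM.PosteriorDefined n pr (EqualVarSEM.data X n ω) →
        1 - EqualVarSEM.posterior n pr (EqualVarSEM.data X n ω) γs ≤
          1 / √(n : ℝ) * Real.exp (A n ω) +
            EqualVarSEM.expTerm γs n (EqualVarSEM.minGap P (X 0) σ γs) (B n ω)) ∧
    -- the first term is dispensable if the true DAG is complete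
    (γs.IsComplete → ∃ B : ℕ → Ω → ℝ, EqualVarSEM.IsLittleOp P B ∧
      ∀ n : ℕ, 1 ≤ n → ∀ ω, EqualVarSEM.PosteriorDefined n pr (EqualVarSEM.data X n ω) →
        1 - EqualVarSEM.posterior n pr (EqualVarSEM.data X n ω) γs ≤
          EqualVarSEM.expTerm γs n (EqualVarSEM.minGap P (X 0) σ γs) (B n ω)) ∧
    -- posterior selection consistency
    TendstoInMeasure P
      (fun (n : ℕ) ω => EqualVarSEM.posterior n pr (EqualVarSEM.data X n ω) γs)
      atTop (fun _ => 1) := by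
  obtain ⟨D, -, hDs, hDt⟩ := hX.exists_measurable_subset_posteriorDefined hp pr hpos
  refine ⟨fun hne => hX.isLeast_minGap hp hne, ?_, ?_, ?_, ?_⟩
  -- The probability is squeezed between that of the measurable event `D n` and one.
  · refine tendsto_of_tendsto_of_tendsto_of_le_of_le' hDt tendsto_const_nhds ?_
      (Eventually.of_forall fun _ => prob_le_one)
    filter_upwards [eventually_ge_atTop 1] with n hn
    exact measure_mono (hDs n hn)
  · exact ⟨_, _, hX.isBigOp_totalExcess hp C, hX.isLittleOp_totalDeviation hp C,
      fun n hn ω hdef => hX.one_sub_posterior_le_exp hp hpos hC hprior hn hdef⟩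
  · intro hcomplete
    refine ⟨_, hX.isLittleOp_totalDeviation hp C, fun n hn ω hdef => ?_⟩
    have h := hX.one_sub_posterior_le_sum hp hpos hC hprior hn hdef
    have hempty : EqualVarSEM.IsSample.properSupergraphs γs = ∅ := by
      refine Finset.eq_empty_of_forall_notMem fun γ hγ => ?_
      simp only [EqualVarSEM.IsSample.properSupergraphs, Finset.mem_filter] at hγ
      exact hγ.2.1 (EqualVarSEM.DAG.eq_of_isComplete hcomplete hγ.2.2)
    rwa [hempty, Finset.sum_empty, zero_add] at h
  · exact hX.tendstoInMeasure_posterior hp hpos hC hprior
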